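/- Let $d\ge 2$, let $\|\cdot\|$ be the Euclidean norm on $\mathbb R^d$, and let $\alpha>1$. Let $X_1,X_2,\dots$ be i.i.d. random vectors in $\mathbb R^d$ with $\mathbf E X_1=0$ that are multivariate regularly varying with index $\alpha$ and limit measure $\mu$. That is, $\mu$ is a non-null Borel measure on $\mathbb R^d\setminus\{0\}$, finite on sets bounded away from $0$, with $\mu(uB)=u^{-\alpha}\mu(B)$ for all $u>0$ and all Borel sets $B$; and there are positive numbers $a_n\uparrow\infty$ such that $$\lim_{n\to\infty} n\,\mathbf P\big(a_n^{-1}X_1\in B\big)=\mu(B)$$ for every Borel set $B$ with $0\notin\overline B$ and $\mu(\partial B)=0$. Assume that the angular measure $$\varsigma(D)=\mu\big(\{x:\|x\|>1,\ x/\|x\|\in D\}\big),\qquad D\subseteq\mathbb S^{d-1}\text{ Borel},$$ is absolutely continuous with respect to Lebesgue (surface) measure on $\mathbb S^{d-1}$ and positive on the sphere, in the sense that $\varsigma(D)>0$ for every non-empty relatively open $D\subseteq\mathbb S^{d-1}$. Let $A\subset\mathbb R^d$ be a compact convex set with non-empty interior $A^\circ$ such that $0\notin A$ and $\mathbf P(X_1\in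 A^\circ)>0$. For $\varphi\in\Xi(A)=\{x/\|x\|:x\in A\}$ put $L_\varphi=\inf\{r:r\varphi\in A\}$ and $U_\varphi=\sup\{r:r\varphi\in A\}$, and let $r^*=\sup_{\varphi\in\Xi(A)}U_\varphi/L_\varphi$. Then, with $S_k=X_1+\dots+X_k$, $$\lim_{n\to\infty}\frac1{(\log n)^2}\log\mathbf P\big(k^{-1}S_k\in A\text{ for all }k=1,\dots,n\big)=-\frac{\alpha-1}{2\log r^*}.$$ -/

import Mathlib

open MeasureTheory ProbabilityTheory Filter Topology
open scoped Pointwise ENNReal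

/-- The random vector `X` is multivariate regularly varying with index `α` and limit measure `μ`,
i.e. `X ∈ RV(α, μ)`.

The measure `μ`, which lives on the punctured compactified space and does not charge the points at
infinity, is encoded as a measure on `ℝ^d` without mass at the origin; the Radon property on the
punctured compactified space (whose relatively compact sets are the sets bounded away from the
origin) then says that `μ` is finite outside every neighbourhood of the origin. -/
structure IsMultRegVarying {d : ℕ} {Ω : Type*} [MeasurableSpace Ω] (P : Measure Ω)
    (X : Ω → EuclideanSpace ℝ (Fin d)) (α : ℝ) (μ : Measure (EuclideanSpace ℝ (Fin d))) :
    Prop where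
  zero_mass : μ {0} = 0
  ne_zero : μ ≠ 0
  radon : ∀ ε : ℝ, 0 < ε → μ {x | ε ≤ ‖x‖} < ∞
  homogeneous : ∀ u : ℝ, 0 < u → ∀ B : Set (EuclideanSpace ℝ (Fin d)), MeasurableSet B →
    μ (u • B) = ENNReal.ofReal (u ^ (-α)) * μ B
  exists_scaling : ∃ a : ℕ → ℝ, (∀ n, 0 < a n) ∧ Monotone a ∧ Tendsto a atTop atTop ∧
    ∀ B : Set (EuclideanSpace ℝ (Fin d)), MeasurableSet B → 0 ∉ closure B → μ (frontier B) = 0 →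
      Tendsto (fun n : ℕ => (n : ℝ≥0∞) * P {ω | (a n)⁻¹ • X ω ∈ B}) atTop (𝓝 (μ B))

/-- The angular (spectral) measure of `μ` on the unit sphere:
`ς(D) = μ {x : ‖x‖ > 1, x / ‖x‖ ∈ D}`. For `μ` homogeneous of order `-α` this is the measure for
which `μ = ν_α ⊗ ς` in polar coordinates, where `ν_α (x, ∞) = x ^ (-α)`. -/
noncomputable def angularMeasure {d : ℕ} (μ : Measure (EuclideanSpace ℝ (Fin d))) :
    Measure (Metric.sphere (0 : EuclideanSpace ℝ (Fin d)) 1) :=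
  ((μ.restrict {x | 1 < ‖x‖}).map (fun x => ‖x‖⁻¹ • x)).comap Subtype.val

theorem angularMeasure_apply {d : ℕ} (μ : Measure (EuclideanSpace ℝ (Fin d)))
    {D : Set (Metric.sphere (0 : EuclideanSpace ℝ (Fin d)) 1)} (hD : MeasurableSet D) :
    angularMeasure μ D = μ {x | 1 < ‖x‖ ∧ ‖x‖⁻¹ • x ∈ Subtype.val '' D} := by
  have hS : MeasurableSet (Metric.sphere (0 : EuclideanSpace ℝ (Fin d)) 1) :=
    Metric.isClosed_sphere.measurableSet
  have hm : Measurable (fun x : EuclideanSpace ℝ (Fin d) => ‖x‖⁻¹ • x) :=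
    (measurable_norm.inv).smul measurable_id
  have hD' := hS.subtype_image hD
  rw [angularMeasure, (MeasurableEmbedding.subtype_coe hS).comap_apply, Measure.map_apply hm hD',
    Measure.restrict_apply (hm hD')]
  congr 1
  ext x
  exact and_comm

/-- The set `Ξ(A)` of directions `x / ‖x‖` of the points `x` of `A`. -/
def directions {d : ℕ} (A : Set (EuclideanSpace ℝ (Fin d))) : Set (EuclideanSpace ℝ (Fin d)) :=
  (fun x => ‖x‖⁻¹ • x) '' A

/-- The entry radius `L_φ = inf {r : r φ ∈ A}`. -/
noncomputable def entryRadius {d : ℕ} (A : Set (EuclideanSpace ℝ (Fin d)))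
    (φ : EuclideanSpace ℝ (Fin d)) : ℝ :=
  sInf {r : ℝ | r • φ ∈ A}

/-- The exit radius `U_φ = sup {r : r φ ∈ A}`. -/
noncomputable def exitRadius {d : ℕ} (A : Set (EuclideanSpace ℝ (Fin d)))
    (φ : EuclideanSpace ℝ (Fin d)) : ℝ :=
  sSup {r : ℝ | r • φ ∈ A}

/-- `r* = sup_{φ ∈ Ξ(A)} U_φ / L_φ`. -/
noncomputable def rStar {d : ℕ} (A : Set (EuclideanSpace ℝ (Fin d))) : ℝ :=
  sSup ((fun φ => exitRadius A φ / entryRadius A φ) '' directions A)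

/-- The event that `S_k / k ∈ A` for all `k = 1, …, n`, where `S_k` is the sum of the first `k`
steps `X 0, …, X (k - 1)`. -/
def persistenceEvent {d : ℕ} {Ω : Type*} (X : ℕ → Ω → EuclideanSpace ℝ (Fin d))
    (A : Set (EuclideanSpace ℝ (Fin d))) (n : ℕ) : Set Ω :=
  {ω | ∀ k : ℕ, 1 ≤ k → k ≤ n → (k : ℝ)⁻¹ • ∑ i ∈ Finset.range k, X i ω ∈ A}

/-!
Between large jumps `S_k` is almost constant, so that `S_k / k` moves along a ray towards the
origin. A ray crosses `A` in a segment whose ends have ratio at most `r*`, so a large jump of the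
order of time is needed at least once in each time block `[r ^ j, r ^ (j + 1)]` with `r > r*`, and
one suitable jump per block is enough if `r < r*`. Such a jump has
probability `r ^ (-(α - 1 + o(1)) j)`: there are about `r ^ j` possible times for it, and at each of
them it has probability `r ^ (-(α + o(1)) j)`. Multiplying over the `log n / log r` blocks up to
time `n` gives `exp (-(α - 1) (log n)² / (2 log r))`.

The power bounds for the tails come from comparing the tail at `x` and at `2 x` along the scaling
sequence (`IsMultRegVarying.tail_le`, `IsMultRegVarying.le_measure_ball`); that a ball in any
direction can be hit uses the positivity of the angular measure
(`IsMultRegVarying.measure_open_pos`). The second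
analytic ingredient is a Fuk–Nagaev type inequality, proved by truncation and exponential moments
(`maximal_deviation`): the maximum of the first `m` partial sums exceeds `δ m` with probability at
most `m ^ (-(α - 1) + o(1))`.

For the upper bound (`persistence_upper_bound`) compactness of `A` gives a distance `δ > 0` between
`A` and its contractions by factors of at least `r > r*`. Hence the increments over the blocks, which
are independent, all have to be of the order of time, and `maximal_deviation` applies to each.

For the lower bound (`persistence_lower_bound`) convexity gives an interior point `w` with `w / r`
also in the interior (`exists_interior_ray`). Starting near `t w` at time `t`, the walk is kept
within small fluctuations except for one jump by about `(1 - 1 / r) r t w` shortly before time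
`r t`, which takes it back near the ray end `r t w` (`goodPath_step`). The possibilities for the time
of this jump are disjoint events, so their probabilities add up (`le_measure_exists_jumpPath`). The
errors do not accumulate because the passage from `t` to `r t` contracts them.
-/

/-! ### Power bounds for a regularly varying tail along a scaling sequence -/

theorem exists_pos_of_atTop {p : ℝ → Prop} (h : ∀ᶠ x in atTop, p x ∧ 0 < x) :
    ∃ x₀ : ℝ, 0 < x₀ ∧ ∀ x, x₀ ≤ x → p x := by
  obtain ⟨x₀, hx₀⟩ := eventually_atTop.1 h
  exact ⟨x₀, (hx₀ x₀ le_rfl).2, fun x hx => (hx₀ x hx).1⟩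

/-- Every large `x` lies between two consecutive terms of a sequence tending to infinity. -/
theorem exists_ge_le_lt_succ {a : ℕ → ℝ} (ha : Tendsto a atTop atTop) (N : ℕ) {x : ℝ}
    (hx : a N ≤ x) : ∃ n, N ≤ n ∧ a n ≤ x ∧ x < a (n + 1) := by
  classical
  have hex : ∃ m, x < a (N + m) := by
    obtain ⟨m, hm, hm'⟩ := ((ha.eventually_gt_atTop x).and (eventually_ge_atTop N)).exists
    exact ⟨m - N, by rwa [Nat.add_sub_cancel' hm']⟩
  have h1 := Nat.find_spec hex
  rcases Nat.eq_zero_or_pos (Nat.find hex) with h0 | h0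
  · rw [h0] at h1
    exact absurd hx (not_le.2 (by simpa using h1))
  · refine ⟨N + (Nat.find hex - 1), by omega, ?_, ?_⟩
    · exact not_lt.1 (Nat.find_min hex (by omega))
    · rwa [show N + (Nat.find hex - 1) + 1 = N + Nat.find hex by omega]

/-- A property of consecutive terms that holds eventually gives a property of all large reals. -/
theorem eventually_of_scaling {a : ℕ → ℝ} (ha : Tendsto a atTop atTop) {p : ℕ → Prop}
    (hp : ∀ᶠ n in atTop, p n) :
    ∀ᶠ x : ℝ in atTop, ∃ n, p n ∧ a n ≤ x ∧ x < a (n + 1) := by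
  obtain ⟨N, hN⟩ := eventually_atTop.1 hp
  filter_upwards [eventually_ge_atTop (a N)] with x hx
  obtain ⟨n, hn, h⟩ := exists_ge_le_lt_succ ha N hx
  exact ⟨n, hN n hn, h⟩

theorem tendsto_mul_shift {G : ℝ → ℝ} {a : ℕ → ℝ} {u l : ℝ}
    (h : Tendsto (fun n : ℕ => (n : ℝ) * G (u * a n)) atTop (𝓝 l)) :
    Tendsto (fun n : ℕ => (n : ℝ) * G (u * a (n + 1))) atTop (𝓝 l) := by
  have h1 := (tendsto_add_atTop_iff_nat 1).2 h
  have h2 : Tendsto (fun n : ℕ => (n : ℝ) / ((n : ℝ) + 1)) atTop (𝓝 1) :=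
    tendsto_natCast_div_add_atTop 1
  have h3 := h2.mul h1
  rw [one_mul] at h3
  refine h3.congr fun n => ?_
  have : ((n : ℝ) + 1) ≠ 0 := by positivity
  push_cast
  field_simp

theorem eventually_lt_of_tendsto_mul {g h : ℕ → ℝ} {l m : ℝ} (hlm : l < m)
    (hg : Tendsto (fun n : ℕ => (n : ℝ) * g n) atTop (𝓝 l))
    (hh : Tendsto (fun n : ℕ => (n : ℝ) * h n) atTop (𝓝 m)) :
    ∀ᶠ n in atTop, g n < h n := by
  filter_upwards [hg.eventually_lt hh hlm] with n hn
  exact lt_of_mul_lt_mul_left hn (Nat.cast_nonneg n)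

section Scaling

variable {G : ℝ → ℝ} {a : ℕ → ℝ} {c α : ℝ}

/-- The scaling sequence of a regularly varying tail has no large multiplicative gaps. -/
theorem scaling_succ_le (hG : Antitone G) (hα : 0 < α) (hc : 0 < c)
    (h : ∀ u : ℝ, 0 < u → Tendsto (fun n : ℕ => (n : ℝ) * G (u * a n)) atTop (𝓝 (c * u ^ (-α))))
    {η : ℝ} (hη : 0 < η) : ∀ᶠ n in atTop, a (n + 1) ≤ (1 + η) * a n := by
  have h1 := tendsto_mul_shift (h 1 one_pos)
  have h2 := h (1 + η) (by linarith)
  have hlt : c * (1 + η) ^ (-α) < c * 1 ^ (-α) := by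
    rw [Real.one_rpow]
    exact mul_lt_mul_of_pos_left (Real.rpow_lt_one_of_one_lt_of_neg (by linarith) (by linarith)) hc
  filter_upwards [eventually_lt_of_tendsto_mul hlt h2 h1] with n hn
  by_contra! hcon
  rw [one_mul] at hn
  exact absurd (hG hcon.le) (not_le.2 hn)

theorem tail_pos (hG : Antitone G) (ha : Tendsto a atTop atTop) (hc : 0 < c)
    (h : ∀ u : ℝ, 0 < u → Tendsto (fun n : ℕ => (n : ℝ) * G (u * a n)) atTop (𝓝 (c * u ^ (-α))))
    (x : ℝ) : 0 < G x := by
  have h1 := h 1 one_pos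
  simp only [one_mul, Real.one_rpow, mul_one] at h1
  obtain ⟨n, hn, hn'⟩ := ((h1.eventually_const_lt hc).and (ha.eventually_ge_atTop x)).exists
  exact (pos_of_mul_pos_right hn (Nat.cast_nonneg n)).trans_le (hG hn')

/-- Along the scaling sequence, the tails at `2 x` and at `x` have the asymptotic ratio `2 ^ (-α)`.
-/
theorem tail_two_mul_le (hG : Antitone G) (ha : Tendsto a atTop atTop) (hc : 0 < c)
    (h : ∀ u : ℝ, 0 < u → Tendsto (fun n : ℕ => (n : ℝ) * G (u * a n)) atTop (𝓝 (c * u ^ (-α))))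
    {q : ℝ} (hq : q < α) : ∀ᶠ x : ℝ in atTop, G (2 * x) ≤ 2 ^ (-q) * G x := by
  have h1 := (tendsto_mul_shift (h 1 one_pos)).const_mul ((2 : ℝ) ^ (-q))
  have h2 := h 2 two_pos
  have hlt : c * 2 ^ (-α) < 2 ^ (-q) * (c * 1 ^ (-α)) := by
    rw [Real.one_rpow, mul_one, mul_comm]
    exact mul_lt_mul_of_pos_right (Real.rpow_lt_rpow_of_exponent_lt one_lt_two (by linarith)) hc
  have h3 := eventually_lt_of_tendsto_mul hlt h2 (h1.congr fun n => mul_left_comm _ _ _)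
  filter_upwards [eventually_of_scaling ha h3] with x ⟨n, hn, hx, hx'⟩
  rw [one_mul] at hn
  calc G (2 * x) ≤ G (2 * a n) := hG (by linarith)
    _ ≤ 2 ^ (-q) * G (a (n + 1)) := hn.le
    _ ≤ 2 ^ (-q) * G x := by gcongr; exact hG hx'.le

theorem le_tail_two_mul (hG : Antitone G) (ha : Tendsto a atTop atTop) (hc : 0 < c)
    (h : ∀ u : ℝ, 0 < u → Tendsto (fun n : ℕ => (n : ℝ) * G (u * a n)) atTop (𝓝 (c * u ^ (-α))))
    {q : ℝ} (hq : α < q) : ∀ᶠ x : ℝ in atTop, 2 ^ (-q) * G x ≤ G (2 * x) := by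
  have h1 := (h 1 one_pos).const_mul ((2 : ℝ) ^ (-q))
  have h2 := tendsto_mul_shift (h 2 two_pos)
  have hlt : 2 ^ (-q) * (c * 1 ^ (-α)) < c * 2 ^ (-α) := by
    rw [Real.one_rpow, mul_one, mul_comm c]
    exact mul_lt_mul_of_pos_right (Real.rpow_lt_rpow_of_exponent_lt one_lt_two (by linarith)) hc
  have h3 := eventually_lt_of_tendsto_mul hlt (h1.congr fun n => mul_left_comm _ _ _) h2
  filter_upwards [eventually_of_scaling ha h3] with x ⟨n, hn, hx, hx'⟩
  rw [one_mul] at hn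
  calc 2 ^ (-q) * G x ≤ 2 ^ (-q) * G (a n) := by gcongr; exact hG hx
    _ ≤ G (2 * a (n + 1)) := hn.le
    _ ≤ G (2 * x) := hG (by linarith)

end Scaling

/-- Induction over dyadic scales: a property that passes from `x / 2` to `x` and holds on
`[x₀, 2 x₀]` holds on `[x₀, ∞)`. -/
theorem dyadic_induction {p : ℝ → Prop} {x₀ : ℝ} (hx₀ : 0 < x₀)
    (base : ∀ x, x₀ ≤ x → x ≤ 2 * x₀ → p x) (step : ∀ x, x₀ ≤ x → p x → p (2 * x)) :
    ∀ x, x₀ ≤ x → p x := by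
  have key : ∀ k : ℕ, ∀ x, x₀ ≤ x → x ≤ 2 ^ k * (2 * x₀) → p x := by
    intro k
    induction k with
    | zero => intro x h1 h2; exact base x h1 (by simpa using h2)
    | succ k ih =>
      intro x h1 h2
      rcases le_total x (2 * x₀) with h3 | h3
      · exact base x h1 h3
      · have := step (x / 2) (by linarith) (ih (x / 2) (by linarith) (by rw [pow_succ] at h2; linarith))
        rwa [mul_div_cancel₀ x two_ne_zero] at this
  intro x hx
  obtain ⟨m, hm⟩ := pow_unbounded_of_one_lt (x / (2 * x₀)) one_lt_two
  exact key m x hx ((div_lt_iff₀ (by positivity)).1 hm).le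

theorem two_mul_rpow_neg {x q : ℝ} (hx : 0 < x) : (2 * x) ^ (-q) = 2 ^ (-q) * x ^ (-q) :=
  Real.mul_rpow zero_le_two hx.le

section PowerBounds

variable {G : ℝ → ℝ} {a : ℕ → ℝ} {c α : ℝ}

theorem tail_le_const_mul (hG : Antitone G) (ha : Tendsto a atTop atTop) (hc : 0 < c)
    (h : ∀ u : ℝ, 0 < u → Tendsto (fun n : ℕ => (n : ℝ) * G (u * a n)) atTop (𝓝 (c * u ^ (-α))))
    {q : ℝ} (hq₀ : 0 < q) (hq : q < α) :
    ∃ C x₀ : ℝ, 0 < C ∧ 0 < x₀ ∧ ∀ x, x₀ ≤ x → G x ≤ C * x ^ (-q) := by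
  obtain ⟨x₀, hx₀, hx₀'⟩ := exists_pos_of_atTop
    ((tail_two_mul_le hG ha hc h hq).and (eventually_gt_atTop 0))
  refine ⟨G x₀ * (2 * x₀) ^ q, x₀, mul_pos (tail_pos hG ha hc h _) (by positivity), hx₀,
    dyadic_induction hx₀ (fun x h1 h2 => ?_) (fun x h1 h2 => ?_)⟩
  · have hx : 0 < x := hx₀.trans_le h1
    have : 1 ≤ (2 * x₀) ^ q * x ^ (-q) := by
      rw [Real.rpow_neg hx.le, ← div_eq_mul_inv, ← Real.div_rpow (by positivity) hx.le]
      exact Real.one_le_rpow ((one_le_div hx).2 h2) hq₀.le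
    calc G x ≤ G x₀ * 1 := by rw [mul_one]; exact hG h1
      _ ≤ G x₀ * ((2 * x₀) ^ q * x ^ (-q)) :=
        mul_le_mul_of_nonneg_left this (tail_pos hG ha hc h _).le
      _ = _ := by ring
  · rw [two_mul_rpow_neg (hx₀.trans_le h1)]
    calc G (2 * x) ≤ 2 ^ (-q) * G x := hx₀' x h1
      _ ≤ 2 ^ (-q) * (G x₀ * (2 * x₀) ^ q * x ^ (-q)) := by gcongr
      _ = _ := by ring

theorem const_mul_le_tail (hG : Antitone G) (ha : Tendsto a atTop atTop) (hc : 0 < c)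
    (h : ∀ u : ℝ, 0 < u → Tendsto (fun n : ℕ => (n : ℝ) * G (u * a n)) atTop (𝓝 (c * u ^ (-α))))
    {q : ℝ} (hq₀ : 0 < q) (hq : α < q) :
    ∃ C x₀ : ℝ, 0 < C ∧ 0 < x₀ ∧ ∀ x, x₀ ≤ x → C * x ^ (-q) ≤ G x := by
  obtain ⟨x₀, hx₀, hx₀'⟩ := exists_pos_of_atTop
    ((le_tail_two_mul hG ha hc h hq).and (eventually_gt_atTop 0))
  refine ⟨G (2 * x₀) * x₀ ^ q, x₀, mul_pos (tail_pos hG ha hc h _) (by positivity), hx₀,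
    dyadic_induction hx₀ (fun x h1 h2 => ?_) (fun x h1 h2 => ?_)⟩
  · have hx : 0 < x := hx₀.trans_le h1
    have : x₀ ^ q * x ^ (-q) ≤ 1 := by
      rw [Real.rpow_neg hx.le, ← div_eq_mul_inv, ← Real.div_rpow (by positivity) hx.le]
      exact Real.rpow_le_one (by positivity) ((div_le_one hx).2 h1) hq₀.le
    calc G (2 * x₀) * x₀ ^ q * x ^ (-q) = G (2 * x₀) * (x₀ ^ q * x ^ (-q)) := by ring
      _ ≤ G (2 * x₀) * 1 := mul_le_mul_of_nonneg_left this (tail_pos hG ha hc h _).le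
      _ ≤ G x := by rw [mul_one]; exact hG h2
  · rw [two_mul_rpow_neg (hx₀.trans_le h1)]
    calc G (2 * x₀) * x₀ ^ q * (2 ^ (-q) * x ^ (-q))
        = 2 ^ (-q) * (G (2 * x₀) * x₀ ^ q * x ^ (-q)) := by ring
      _ ≤ 2 ^ (-q) * G x := by gcongr
      _ ≤ G (2 * x) := hx₀' x h1

end PowerBounds

/-- A strictly larger power absorbs a constant factor. -/
theorem eventually_const_mul_rpow_le (C : ℝ) {p q : ℝ} (hpq : p < q) :
    ∀ᶠ x : ℝ in atTop, C * x ^ p ≤ x ^ q := by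
  filter_upwards [(tendsto_rpow_atTop (sub_pos.2 hpq)).eventually_ge_atTop C,
    eventually_gt_atTop 0] with x hx hx0
  calc C * x ^ p ≤ x ^ (q - p) * x ^ p := by gcongr
    _ = x ^ q := by rw [← Real.rpow_add hx0]; congr 1; ring

/-! ### The limit measure of a regularly varying vector -/

section LimitMeasure

variable {d : ℕ} {Ω : Type*} [MeasurableSpace Ω] {P : Measure Ω}
  {X : Ω → EuclideanSpace ℝ (Fin d)} {α : ℝ} {μ : Measure (EuclideanSpace ℝ (Fin d))}

theorem measurableSet_norm_gt (u : ℝ) :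
    MeasurableSet {x : EuclideanSpace ℝ (Fin d) | u < ‖x‖} :=
  measurableSet_lt measurable_const measurable_norm

/-- Cones truncated at radius `u` are the dilations by `u` of the cone truncated at radius `1`. -/
theorem smul_truncatedCone {u : ℝ} (hu : 0 < u) (D : Set (EuclideanSpace ℝ (Fin d))) :
    u • {x : EuclideanSpace ℝ (Fin d) | 1 < ‖x‖ ∧ ‖x‖⁻¹ • x ∈ D} =
      {x | u < ‖x‖ ∧ ‖x‖⁻¹ • x ∈ D} := by
  ext x
  rw [Set.mem_smul_set_iff_inv_smul_mem₀ hu.ne']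
  simp only [Set.mem_ofPred_eq, norm_smul, norm_inv, Real.norm_of_nonneg hu.le, smul_smul]
  have h1 : (u⁻¹ * ‖x‖)⁻¹ * u⁻¹ = ‖x‖⁻¹ := by
    rw [mul_inv, inv_inv, mul_right_comm, mul_inv_cancel₀ hu.ne', one_mul]
  rw [h1, inv_mul_eq_div, one_lt_div hu]

theorem IsMultRegVarying.measure_truncatedCone (h : IsMultRegVarying P X α μ) {u : ℝ} (hu : 0 < u)
    {D : Set (EuclideanSpace ℝ (Fin d))} (hD : MeasurableSet D) :
    μ {x | u < ‖x‖ ∧ ‖x‖⁻¹ • x ∈ D} =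
      ENNReal.ofReal (u ^ (-α)) * μ {x | 1 < ‖x‖ ∧ ‖x‖⁻¹ • x ∈ D} := by
  rw [← smul_truncatedCone hu, h.homogeneous u hu]
  exact (measurableSet_norm_gt 1).inter ((measurable_norm.inv).smul measurable_id hD)

theorem IsMultRegVarying.measure_norm_gt (h : IsMultRegVarying P X α μ) {u : ℝ} (hu : 0 < u) :
    μ {x | u < ‖x‖} = ENNReal.ofReal (u ^ (-α)) * μ {x | 1 < ‖x‖} := by
  simpa using h.measure_truncatedCone hu MeasurableSet.univ

theorem IsMultRegVarying.measure_norm_gt_lt_top (h : IsMultRegVarying P X α μ) {u : ℝ}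
    (hu : 0 < u) : μ {x | u < ‖x‖} < ∞ :=
  (measure_mono (show {x | u < ‖x‖} ⊆ {x : EuclideanSpace ℝ (Fin d) | u ≤ ‖x‖} from
    fun x hx => show u ≤ ‖x‖ from le_of_lt hx)).trans_lt (h.radon u hu)

/-- By homogeneity the limit measure does not charge spheres around the origin. -/
theorem IsMultRegVarying.measure_norm_eq (h : IsMultRegVarying P X α μ) {u : ℝ} (hu : 0 < u) :
    μ {x | ‖x‖ = u} = 0 := by
  set c := μ {x : EuclideanSpace ℝ (Fin d) | 1 < ‖x‖} with hc
  have hctop : c ≠ ∞ := (h.measure_norm_gt_lt_top one_pos).ne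
  have hle : ∀ v : ℝ, 0 < v → v < u →
      μ {x | ‖x‖ = u} + ENNReal.ofReal (u ^ (-α)) * c ≤ ENNReal.ofReal (v ^ (-α)) * c := by
    intro v hv hvu
    rw [hc, ← h.measure_norm_gt hu, ← h.measure_norm_gt hv, ← measure_union _
      (measurableSet_norm_gt u)]
    · refine measure_mono ?_
      rintro x (hx | hx)
      · exact hvu.trans_eq (Eq.symm hx)
      · exact hvu.trans hx
    · refine Set.disjoint_left.2 fun x hx hx' => ?_
      exact absurd hx (ne_of_gt hx')
  have hlim : Tendsto (fun v : ℝ => ENNReal.ofReal (v ^ (-α)) * c) (𝓝[<] u)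
      (𝓝 (ENNReal.ofReal (u ^ (-α)) * c)) := by
    refine ENNReal.Tendsto.mul_const (ENNReal.tendsto_ofReal ?_) (Or.inr hctop)
    exact ((Real.continuousAt_rpow_const u (-α) (Or.inl hu.ne')).tendsto).mono_left
      nhdsWithin_le_nhds
  have := ge_of_tendsto hlim (by
    filter_upwards [Ioo_mem_nhdsLT hu] with v hv using hle v hv.1 hv.2)
  have hfin : ENNReal.ofReal (u ^ (-α)) * c ≠ ∞ := ENNReal.mul_ne_top ENNReal.ofReal_ne_top hctop
  have h0 : μ {x | ‖x‖ = u} + ENNReal.ofReal (u ^ (-α)) * c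
      ≤ 0 + ENNReal.ofReal (u ^ (-α)) * c := by rwa [zero_add]
  exact le_antisymm ((ENNReal.add_le_add_iff_right hfin).1 h0) (zero_le)

/-- Since the angular measure charges every open set of directions, the limit measure charges
every neighbourhood of every nonzero point: such a neighbourhood contains the difference of two
truncated cones, whose masses differ by homogeneity. -/
theorem IsMultRegVarying.measure_open_pos (h : IsMultRegVarying P X α μ) (hα : 0 < α)
    (hpos : ∀ D : Set (Metric.sphere (0 : EuclideanSpace ℝ (Fin d)) 1),
      IsOpen D → D.Nonempty → 0 < angularMeasure μ D)
    {U : Set (EuclideanSpace ℝ (Fin d))} (hU : IsOpen U) {x : EuclideanSpace ℝ (Fin d)}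
    (hx : x ∈ U) (hx0 : x ≠ 0) : 0 < μ U := by
  have hn : 0 < ‖x‖ := norm_pos_iff.2 hx0
  have hθ : ‖x‖⁻¹ • x ∈ Metric.sphere (0 : EuclideanSpace ℝ (Fin d)) 1 := by
    simp [norm_smul, hn.ne']
  have hcont : Continuous fun z : ℝ × EuclideanSpace ℝ (Fin d) => z.1 • z.2 := by fun_prop
  have hmem : (fun z : ℝ × EuclideanSpace ℝ (Fin d) => z.1 • z.2) ⁻¹' U
      ∈ 𝓝 (‖x‖, ‖x‖⁻¹ • x) := by
    refine hcont.continuousAt.preimage_mem_nhds (hU.mem_nhds ?_)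
    simpa [smul_smul, hn.ne'] using hx
  rw [nhds_prod_eq, mem_prod_iff] at hmem
  obtain ⟨I, hI, V, hV, hIV⟩ := hmem
  obtain ⟨ε, hε, hεI⟩ := Metric.mem_nhds_iff.1 hI
  obtain ⟨W, hWV, hW, hxW⟩ := mem_nhds_iff.1 hV
  have hD := hpos (Subtype.val ⁻¹' W) (hW.preimage continuous_subtype_val) ⟨⟨_, hθ⟩, hxW⟩
  rw [angularMeasure_apply μ (hW.preimage continuous_subtype_val).measurableSet] at hD
  set D := Subtype.val '' ((Subtype.val : Metric.sphere (0 : EuclideanSpace ℝ (Fin d)) 1 → _) ⁻¹' W)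
    with hDdef
  have hDm : MeasurableSet D :=
    (Metric.isClosed_sphere.measurableSet).subtype_image
      (hW.preimage continuous_subtype_val).measurableSet
  have hDfin : μ {x | 1 < ‖x‖ ∧ ‖x‖⁻¹ • x ∈ D} ≠ ∞ :=
    ((measure_mono (show {x | 1 < ‖x‖ ∧ ‖x‖⁻¹ • x ∈ D} ⊆ {x | 1 < ‖x‖} from
      fun _ hx => hx.1)).trans_lt (h.measure_norm_gt_lt_top one_pos)).ne
  by_contra hcon
  have hU0 : μ U = 0 := by simpa using hcon
  have hsub : {y : EuclideanSpace ℝ (Fin d) | ‖x‖ < ‖y‖ ∧ ‖y‖⁻¹ • y ∈ D} ⊆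
      {y | ‖x‖ + ε / 2 < ‖y‖ ∧ ‖y‖⁻¹ • y ∈ D} ∪ U := by
    rintro y ⟨hy1, hy2⟩
    rcases lt_or_ge (‖x‖ + ε / 2) ‖y‖ with h3 | h3
    · exact Or.inl ⟨h3, hy2⟩
    · refine Or.inr ?_
      obtain ⟨θ, hθW, hθy⟩ := hy2
      have hyI : ‖y‖ ∈ I := hεI (by
        rw [Metric.mem_ball, Real.dist_eq, abs_of_pos (by linarith)]; linarith)
      have hyV : ‖y‖⁻¹ • y ∈ V := hWV (hθy ▸ hθW)
      have := hIV (Set.mk_mem_prod hyI hyV)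
      simpa [smul_smul, (hn.trans hy1).ne'] using this
  have hle := (measure_mono (μ := μ) hsub).trans (measure_union_le _ _)
  rw [hU0, add_zero, h.measure_truncatedCone hn hDm,
    h.measure_truncatedCone (u := ‖x‖ + ε / 2) (by positivity) hDm] at hle
  have hle' := (ENNReal.mul_le_mul_iff_left hD.ne' hDfin).1 hle
  refine absurd hle' (not_le.2 ?_)
  exact (ENNReal.ofReal_lt_ofReal_iff (by positivity)).2
    (Real.rpow_lt_rpow_of_neg hn (by linarith) (by linarith))

/-- Around every nonzero point there are balls whose boundary is a null set of the limit
measure. -/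
theorem IsMultRegVarying.exists_null_frontier_ball (h : IsMultRegVarying P X α μ)
    {b : EuclideanSpace ℝ (Fin d)} (hb : b ≠ 0) {ρ : ℝ} (hρ : 0 < ρ) :
    ∃ s, 0 < s ∧ s ≤ ρ ∧ s ≤ ‖b‖ / 2 ∧ μ (frontier (Metric.ball b s)) = 0 := by
  have hn : 0 < ‖b‖ := norm_pos_iff.2 hb
  have hfin : IsFiniteMeasure (μ.restrict {x | ‖b‖ / 2 ≤ ‖x‖}) :=
    ⟨by rw [Measure.restrict_apply_univ]; exact h.radon _ (by positivity)⟩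
  obtain ⟨s, hs, hs0⟩ := exists_null_frontier_thickening (μ.restrict {x | ‖b‖ / 2 ≤ ‖x‖}) {b}
    (lt_min hρ (half_pos hn))
  rw [Metric.thickening_singleton] at hs0
  refine ⟨s, hs.1, hs.2.le.trans (min_le_left _ _), hs.2.le.trans (min_le_right _ _), ?_⟩
  rwa [Measure.restrict_apply isClosed_frontier.measurableSet, Set.inter_eq_left.2] at hs0
  intro y hy
  have hy' : dist y b ≤ s :=
    Metric.closedBall_subset_closedBall le_rfl (Metric.closure_ball_subset_closedBall
      (frontier_subset_closure hy))
  have h1 : ‖b‖ - ‖y‖ ≤ dist y b := by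
    rw [dist_comm, dist_eq_norm]; exact norm_sub_norm_le _ _
  have h2 := hs.2.le.trans (min_le_right _ _)
  show ‖b‖ / 2 ≤ ‖y‖
  linarith

end LimitMeasure

/-! ### Tail bounds for a regularly varying vector -/

section Tails

variable {d : ℕ} {Ω : Type*} [MeasurableSpace Ω] {P : Measure Ω} [IsProbabilityMeasure P]
  {X : Ω → EuclideanSpace ℝ (Fin d)} {α : ℝ} {μ : Measure (EuclideanSpace ℝ (Fin d))}

theorem antitone_tail (X : Ω → EuclideanSpace ℝ (Fin d)) :
    Antitone fun x : ℝ => P.real {ω | x < ‖X ω‖} := by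
  intro x y hxy
  exact measureReal_mono fun ω hω => lt_of_le_of_lt hxy hω

theorem tendsto_mul_measureReal {P : Measure Ω} {E : ℕ → Set Ω} {l : ℝ≥0∞} (hl : l ≠ ∞)
    (h : Tendsto (fun n : ℕ => (n : ℝ≥0∞) * P (E n)) atTop (𝓝 l)) :
    Tendsto (fun n : ℕ => (n : ℝ) * P.real (E n)) atTop (𝓝 l.toReal) := by
  refine ((ENNReal.tendsto_toReal hl).comp h).congr fun n => ?_
  simp [Measure.real]

/-- The scaling sequence normalises the tail of the norm, with a positive limit. -/
theorem IsMultRegVarying.exists_norm_scaling {P : Measure Ω} (h : IsMultRegVarying P X α μ)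
    (hμ : 0 < μ {x | 1 < ‖x‖}) :
    ∃ (a : ℕ → ℝ) (c : ℝ), (∀ n, 0 < a n) ∧ Tendsto a atTop atTop ∧ 0 < c ∧
      (∀ u : ℝ, 0 < u → Tendsto (fun n : ℕ => (n : ℝ) * P.real {ω | u * a n < ‖X ω‖}) atTop
        (𝓝 (c * u ^ (-α)))) ∧
      ∀ B : Set (EuclideanSpace ℝ (Fin d)), MeasurableSet B → 0 ∉ closure B →
        μ (frontier B) = 0 → μ B ≠ ∞ →
        Tendsto (fun n : ℕ => (n : ℝ) * P.real {ω | (a n)⁻¹ • X ω ∈ B}) atTop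
          (𝓝 (μ B).toReal) := by
  obtain ⟨a, ha0, -, ha, hlim⟩ := h.exists_scaling
  have hctop := (h.measure_norm_gt_lt_top one_pos).ne
  refine ⟨a, (μ {x | 1 < ‖x‖}).toReal, ha0, ha, ENNReal.toReal_pos hμ.ne' hctop, ?_,
    fun B hB h0 hf hBtop => tendsto_mul_measureReal hBtop (hlim B hB h0 hf)⟩
  intro u hu
  have hcl : closure {x : EuclideanSpace ℝ (Fin d) | u < ‖x‖} ⊆ {x | u ≤ ‖x‖} :=
    closure_minimal (fun x hx => show u ≤ ‖x‖ from le_of_lt hx) (isClosed_le continuous_const continuous_norm)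
  have h0 : (0 : EuclideanSpace ℝ (Fin d)) ∉ closure {x | u < ‖x‖} := by
    intro h0
    have : u ≤ ‖(0 : EuclideanSpace ℝ (Fin d))‖ := hcl h0
    rw [norm_zero] at this
    linarith
  have hf : μ (frontier {x : EuclideanSpace ℝ (Fin d) | u < ‖x‖}) = 0 := by
    refine measure_mono_null ?_ (h.measure_norm_eq hu)
    intro x hx
    exact (frontier_lt_subset_eq continuous_const continuous_norm hx).symm
  have h1 := tendsto_mul_measureReal (h.measure_norm_gt_lt_top hu).ne
    (hlim _ (measurableSet_norm_gt u) h0 hf)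
  rw [h.measure_norm_gt hu, ENNReal.toReal_mul, ENNReal.toReal_ofReal (by positivity),
    mul_comm] at h1
  refine h1.congr fun n => ?_
  congr 2
  ext ω
  have hn := ha0 n
  show u < ‖(a n)⁻¹ • X ω‖ ↔ u * a n < ‖X ω‖
  rw [norm_smul, norm_inv, Real.norm_of_nonneg hn.le, inv_mul_eq_div, lt_div_iff₀ hn]

theorem IsMultRegVarying.tail_le (h : IsMultRegVarying P X α μ) (hμ : 0 < μ {x | 1 < ‖x‖})
    {q : ℝ} (hq₀ : 0 < q) (hq : q < α) :
    ∃ C x₀ : ℝ, 0 < C ∧ 0 < x₀ ∧ ∀ x, x₀ ≤ x → P.real {ω | x < ‖X ω‖} ≤ C * x ^ (-q) := by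
  obtain ⟨a, c, -, ha, hc, h1, -⟩ := h.exists_norm_scaling hμ
  exact tail_le_const_mul (antitone_tail X) ha hc h1 hq₀ hq

/-- The probability that `X` falls into the dilation by `x` of a fixed ball decays at most like
`x ^ (-α + o(1))`. -/
theorem IsMultRegVarying.le_measure_ball (h : IsMultRegVarying P X α μ) (hα : 0 < α)
    (hpos : ∀ D : Set (Metric.sphere (0 : EuclideanSpace ℝ (Fin d)) 1),
      IsOpen D → D.Nonempty → 0 < angularMeasure μ D)
    (hμ : 0 < μ {x | 1 < ‖x‖})
    {b : EuclideanSpace ℝ (Fin d)} (hb : b ≠ 0) {ρ q : ℝ} (hρ : 0 < ρ) (hq : α < q) :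
    ∀ᶠ x : ℝ in atTop, x ^ (-q) ≤ P.real {ω | x⁻¹ • X ω ∈ Metric.ball b ρ} := by
  obtain ⟨a, c, ha0, ha, hc, hnorm, hset⟩ := h.exists_norm_scaling hμ
  have hn : 0 < ‖b‖ := norm_pos_iff.2 hb
  obtain ⟨s, hs0, hsρ, hsb, hsf⟩ := h.exists_null_frontier_ball hb (half_pos hρ)
  have hfar : Metric.closedBall b s ⊆ {x : EuclideanSpace ℝ (Fin d) | ‖b‖ / 2 ≤ ‖x‖} := by
    intro y hy
    have h1 : ‖b‖ - ‖y‖ ≤ dist y b := by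
      rw [dist_comm, dist_eq_norm]; exact norm_sub_norm_le _ _
    have h2 := Metric.mem_closedBall.1 hy
    show ‖b‖ / 2 ≤ ‖y‖
    linarith
  have h0 : (0 : EuclideanSpace ℝ (Fin d)) ∉ closure (Metric.ball b s) := by
    intro h0
    have : ‖b‖ / 2 ≤ ‖(0 : EuclideanSpace ℝ (Fin d))‖ :=
      hfar (Metric.closure_ball_subset_closedBall h0)
    rw [norm_zero] at this
    linarith
  have htop : μ (Metric.ball b s) ≠ ∞ :=
    ((measure_mono (Metric.ball_subset_closedBall.trans hfar)).trans_lt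
      (h.radon _ (half_pos hn))).ne
  have hm : 0 < (μ (Metric.ball b s)).toReal := ENNReal.toReal_pos
    (h.measure_open_pos hα hpos Metric.isOpen_ball (Metric.mem_ball_self hs0) hb).ne' htop
  set m := (μ (Metric.ball b s)).toReal
  have hball := hset _ Metric.isOpen_ball.measurableSet h0 hsf htop
  obtain ⟨q', hαq', hq'q⟩ := exists_between hq
  obtain ⟨C, x₀, hC, hx₀, hlow⟩ := const_mul_le_tail (antitone_tail X) ha hc hnorm
    (hα.trans hαq') hαq'
  -- A scale `x` in `[a n, a (n + 1))` is so close to `a n` that the dilation by `a n` of the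
  -- smaller ball is contained in the dilation by `x` of the larger one.
  have hη : 0 < ρ / (2 * ‖b‖) := by positivity
  have hev : ∀ᶠ n : ℕ in atTop, a (n + 1) ≤ (1 + ρ / (2 * ‖b‖)) * a n ∧
      m / (4 * c) * P.real {ω | a n < ‖X ω‖} ≤ P.real {ω | (a n)⁻¹ • X ω ∈ Metric.ball b s} := by
    have h1 := (hnorm 1 one_pos).const_mul (m / (4 * c))
    simp only [one_mul, Real.one_rpow, mul_one] at h1
    have hlt : m / (4 * c) * c < m := by
      field_simp
      linarith
    filter_upwards [scaling_succ_le (antitone_tail X) hα hc hnorm hη,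
      eventually_lt_of_tendsto_mul hlt (h1.congr fun n => mul_left_comm _ _ _) hball] with n h2 h3
    exact ⟨h2, h3.le⟩
  have hpow := eventually_const_mul_rpow_le (m / (4 * c) * C)⁻¹ (neg_lt_neg hq'q)
  filter_upwards [eventually_of_scaling ha hev, eventually_ge_atTop x₀, hpow] with
    x ⟨n, ⟨hgap, hlt⟩, hx, hx'⟩ hxx₀ hpow
  have hxpos : 0 < x := hx₀.trans_le hxx₀
  have hK : 0 < m / (4 * c) * C := by positivity
  rw [inv_mul_le_iff₀ hK] at hpow
  calc x ^ (-q) ≤ m / (4 * c) * C * x ^ (-q') := hpow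
    _ = m / (4 * c) * (C * x ^ (-q')) := by ring
    _ ≤ m / (4 * c) * P.real {ω | x < ‖X ω‖} := by gcongr; exact hlow x hxx₀
    _ ≤ m / (4 * c) * P.real {ω | a n < ‖X ω‖} :=
      mul_le_mul_of_nonneg_left (antitone_tail (P := P) X hx) (by positivity)
    _ ≤ P.real {ω | (a n)⁻¹ • X ω ∈ Metric.ball b s} := hlt
    _ ≤ P.real {ω | x⁻¹ • X ω ∈ Metric.ball b ρ} := by
      refine measureReal_mono fun ω hω => ?_
      have h1 : ‖(a n)⁻¹ • X ω - b‖ < s := by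
        have : (a n)⁻¹ • X ω ∈ Metric.ball b s := hω
        rwa [mem_ball_iff_norm] at this
      show x⁻¹ • X ω ∈ Metric.ball b ρ
      rw [mem_ball_iff_norm]
      have han := ha0 n
      have ht0 : 0 ≤ a n / x := by positivity
      have ht1 : a n / x ≤ 1 := (div_le_one hxpos).2 hx
      have ht2 : (1 - a n / x) * ‖b‖ ≤ ρ / 2 := by
        have : x - a n ≤ ρ / (2 * ‖b‖) * a n := by linarith
        have h3 : 1 - a n / x ≤ ρ / (2 * ‖b‖) := by
          rw [one_sub_div hxpos.ne', div_le_iff₀ hxpos]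
          exact this.trans (by gcongr)
        calc (1 - a n / x) * ‖b‖ ≤ ρ / (2 * ‖b‖) * ‖b‖ := by gcongr
          _ = ρ / 2 := by field_simp
      have heq : x⁻¹ • X ω - b = (a n / x) • ((a n)⁻¹ • X ω - b) - (1 - a n / x) • b := by
        rw [smul_sub, smul_smul, sub_smul, one_smul]
        have : a n / x * (a n)⁻¹ = x⁻¹ := by field_simp
        rw [this]
        abel
      calc ‖x⁻¹ • X ω - b‖ ≤ a n / x * ‖(a n)⁻¹ • X ω - b‖ + (1 - a n / x) * ‖b‖ := by
            rw [heq]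
            refine (norm_sub_le _ _).trans (le_of_eq ?_)
            rw [norm_smul, norm_smul, Real.norm_of_nonneg ht0,
              Real.norm_of_nonneg (sub_nonneg.2 ht1)]
        _ ≤ 1 * ‖(a n)⁻¹ • X ω - b‖ + (1 - a n / x) * ‖b‖ := by gcongr
        _ < ρ := by linarith

/-- Moments of order less than the index of regular variation are finite. -/
theorem IsMultRegVarying.integrable_norm_rpow (h : IsMultRegVarying P X α μ)
    (hX : Measurable X) (hμ : 0 < μ {x | 1 < ‖x‖}) {p : ℝ} (hp : 0 < p) (hpα : p < α) :
    Integrable (fun ω => ‖X ω‖ ^ p) P := by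
  obtain ⟨q, hpq, hqα⟩ := exists_between hpα
  obtain ⟨C, x₀, hC, hx₀, htail⟩ := h.tail_le hμ (hp.trans hpq) hqα
  have hnn : ∀ ω, 0 ≤ ‖X ω‖ ^ p := fun ω => by positivity
  refine ⟨(hX.norm.pow_const p).aestronglyMeasurable, ?_⟩
  rw [hasFiniteIntegral_iff_ofReal (Eventually.of_forall hnn),
    lintegral_rpow_eq_lintegral_meas_lt_mul P (Eventually.of_forall fun ω => norm_nonneg _)
      hX.norm.aemeasurable hp]
  refine ENNReal.mul_lt_top ENNReal.ofReal_lt_top ?_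
  have hsplit : Set.Ioi (0 : ℝ) = Set.Ioc 0 x₀ ∪ Set.Ioi x₀ :=
    (Set.Ioc_union_Ioi_eq_Ioi hx₀.le).symm
  rw [hsplit]
  refine (lintegral_union_le _ _ _).trans_lt (ENNReal.add_lt_top.2 ⟨?_, ?_⟩)
  · have hint : IntegrableOn (fun t : ℝ => t ^ (p - 1)) (Set.Ioc 0 x₀) := by
      rw [← intervalIntegrable_iff_integrableOn_Ioc_of_le hx₀.le]
      exact intervalIntegral.intervalIntegrable_rpow' (by linarith)
    refine lt_of_le_of_lt ?_ hint.lintegral_lt_top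
    refine setLIntegral_mono_ae' measurableSet_Ioc (Eventually.of_forall fun t ht => ?_)
    calc P {ω | t < ‖X ω‖} * ENNReal.ofReal (t ^ (p - 1))
        ≤ 1 * ENNReal.ofReal (t ^ (p - 1)) := by gcongr; exact prob_le_one
      _ = _ := one_mul _
  · have hint : IntegrableOn (fun t : ℝ => C * t ^ (p - 1 - q)) (Set.Ioi x₀) :=
      (integrableOn_Ioi_rpow_of_lt (by linarith) hx₀).const_mul C
    refine lt_of_le_of_lt ?_ hint.lintegral_lt_top
    refine setLIntegral_mono_ae' measurableSet_Ioi (Eventually.of_forall fun t ht => ?_)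
    have ht0 : 0 < t := hx₀.trans ht
    have h1 : P {ω | t < ‖X ω‖} = ENNReal.ofReal (P.real {ω | t < ‖X ω‖}) :=
      (ofReal_measureReal).symm
    rw [h1, ← ENNReal.ofReal_mul measureReal_nonneg]
    refine ENNReal.ofReal_le_ofReal ?_
    calc P.real {ω | t < ‖X ω‖} * t ^ (p - 1) ≤ C * t ^ (-q) * t ^ (p - 1) := by
          gcongr; exact htail t (le_of_lt ht)
      _ = C * t ^ (p - 1 - q) := by
          rw [mul_assoc, ← Real.rpow_add ht0]; congr 2; ring

end Tails

/-! ### Large deviations of sums with heavy-tailed summands -/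

theorem exp_le_one_add_self_add_rpow {p : ℝ} (hp1 : 1 ≤ p) (hp2 : p ≤ 2) (y : ℝ) :
    Real.exp y ≤ 1 + y + |y| ^ p * Real.exp |y| := by
  rcases le_or_gt |y| 1 with h | h
  · have h1 := (abs_le.1 (Real.abs_exp_sub_one_sub_id_le h)).2
    have h2 : y ^ 2 ≤ |y| ^ p := by
      rw [← sq_abs, ← Real.rpow_two]
      exact Real.rpow_le_rpow_of_exponent_ge' (abs_nonneg y) h (by linarith) hp2
    have h3 : |y| ^ p * 1 ≤ |y| ^ p * Real.exp |y| := by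
      gcongr
      exact Real.one_le_exp (abs_nonneg y)
    linarith
  · have h1 : |y| ≤ |y| ^ p := by
      conv_lhs => rw [← Real.rpow_one |y|]
      exact Real.rpow_le_rpow_of_exponent_le h.le hp1
    have h2 : 1 ≤ Real.exp |y| := Real.one_le_exp (abs_nonneg y)
    rcases le_total 0 y with hy | hy
    · rw [abs_of_nonneg hy] at *
      nlinarith [Real.exp_pos y]
    · have h3 : Real.exp y ≤ 1 := Real.exp_le_one_iff.2 hy
      have h4 : |y| * 1 ≤ |y| ^ p * Real.exp |y| := by gcongr
      rw [abs_of_nonpos hy] at *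
      linarith

section Truncation

variable {Ω : Type*} [MeasurableSpace Ω] {P : Measure Ω} [IsProbabilityMeasure P]

theorem abs_sub_truncation_le {Ω : Type*} (ξ : Ω → ℝ) {p T : ℝ} (hp : 1 ≤ p) (hT : 0 < T) (ω : Ω) :
    |ξ ω - truncation ξ T ω| ≤ T ^ (1 - p) * |ξ ω| ^ p := by
  rcases lt_or_ge |ξ ω| T with h | h
  · rw [truncation_eq_self h, sub_self, abs_zero]
    positivity
  · have h0 : 0 < |ξ ω| := hT.trans_le h
    have h1 : |ξ ω - truncation ξ T ω| ≤ |ξ ω| := by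
      simp only [truncation, Function.comp_apply, Set.indicator_apply, id]
      split_ifs
      · simp
      · simp
    calc |ξ ω - truncation ξ T ω| ≤ |ξ ω| := h1
      _ = |ξ ω| ^ (1 - p) * |ξ ω| ^ p := by rw [← Real.rpow_add h0]; simp
      _ ≤ T ^ (1 - p) * |ξ ω| ^ p := by
        gcongr ?_ * _
        exact Real.rpow_le_rpow_of_nonpos hT h (by linarith)

/-- Exponential moments of a truncated centred variable, in terms of a moment of order
`1 ≤ p ≤ 2`. -/
theorem mgf_truncation_le {ξ : Ω → ℝ} {p T t M : ℝ} (hp1 : 1 ≤ p) (hp2 : p ≤ 2) (hT : 0 < T)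
    (ht : 0 ≤ t) (hξ : Integrable ξ P) (hmean : ∫ ω, ξ ω ∂P = 0)
    (hξp : Integrable (fun ω => |ξ ω| ^ p) P) (hM : ∫ ω, |ξ ω| ^ p ∂P ≤ M) :
    mgf (truncation ξ T) P t ≤ Real.exp (M * (t * T ^ (1 - p) + t ^ p * Real.exp (t * T))) := by
  have hY : Integrable (truncation ξ T) P := hξ.aestronglyMeasurable.integrable_truncation
  have hEY : ∫ ω, truncation ξ T ω ∂P ≤ T ^ (1 - p) * M := by
    have h1 : ∫ ω, (ξ ω - truncation ξ T ω) ∂P = - ∫ ω, truncation ξ T ω ∂P := by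
      rw [integral_sub hξ hY, hmean, zero_sub]
    have h2 : - ∫ ω, (ξ ω - truncation ξ T ω) ∂P ≤ ∫ ω, T ^ (1 - p) * |ξ ω| ^ p ∂P := by
      rw [← integral_neg]
      refine integral_mono (hξ.sub hY).neg (hξp.const_mul _) fun ω => ?_
      exact (neg_le_abs _).trans (abs_sub_truncation_le ξ hp1 hT ω)
    rw [integral_const_mul] at h2
    have h3 : T ^ (1 - p) * ∫ ω, |ξ ω| ^ p ∂P ≤ T ^ (1 - p) * M := by gcongr
    linarith
  have hpt : ∀ ω, Real.exp (t * truncation ξ T ω) ≤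
      1 + t * truncation ξ T ω + t ^ p * Real.exp (t * T) * |ξ ω| ^ p := by
    intro ω
    refine (exp_le_one_add_self_add_rpow hp1 hp2 _).trans ?_
    refine add_le_add le_rfl ?_
    have h1 : |t * truncation ξ T ω| ≤ t * |ξ ω| := by
      rw [abs_mul, abs_of_nonneg ht]
      exact mul_le_mul_of_nonneg_left (abs_truncation_le_abs_self ξ T ω) ht
    have h2 : |t * truncation ξ T ω| ≤ t * T := by
      rw [abs_mul, abs_of_nonneg ht]
      gcongr
      exact (abs_truncation_le_bound ξ T ω).trans_eq (abs_of_pos hT)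
    calc |t * truncation ξ T ω| ^ p * Real.exp |t * truncation ξ T ω|
        ≤ (t * |ξ ω|) ^ p * Real.exp (t * T) := by gcongr
      _ = t ^ p * Real.exp (t * T) * |ξ ω| ^ p := by
        rw [Real.mul_rpow ht (abs_nonneg _)]; ring
  have hint2 : Integrable (fun ω => 1 + t * truncation ξ T ω) P :=
    (integrable_const _).add (hY.const_mul t)
  calc mgf (truncation ξ T) P t
      ≤ ∫ ω, (1 + t * truncation ξ T ω + t ^ p * Real.exp (t * T) * |ξ ω| ^ p) ∂P :=
        integral_mono_of_nonneg (Eventually.of_forall fun ω => (Real.exp_pos _).le)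
          (hint2.add (hξp.const_mul _)) (Eventually.of_forall hpt)
    _ = 1 + t * ∫ ω, truncation ξ T ω ∂P + t ^ p * Real.exp (t * T) * ∫ ω, |ξ ω| ^ p ∂P := by
        rw [integral_add hint2 (hξp.const_mul _), integral_add (integrable_const _)
          (hY.const_mul t), integral_const_mul, integral_const_mul]
        simp
    _ ≤ 1 + t * (T ^ (1 - p) * M) + t ^ p * Real.exp (t * T) * M := by gcongr
    _ = M * (t * T ^ (1 - p) + t ^ p * Real.exp (t * T)) + 1 := by ring
    _ ≤ _ := Real.add_one_le_exp _

/-- Chernoff bound for sums of truncated centred variables, uniform in the number `k ≤ m` of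
summands. -/
theorem measure_truncated_sum_ge_le {ξ : ℕ → Ω → ℝ} {p T t M x : ℝ} (hp1 : 1 ≤ p) (hp2 : p ≤ 2)
    (hT : 0 < T) (ht : 0 ≤ t) (hmeas : ∀ i, Measurable (ξ i)) (hind : iIndepFun ξ P)
    (hξ : ∀ i, Integrable (ξ i) P) (hmean : ∀ i, ∫ ω, ξ i ω ∂P = 0)
    (hξp : ∀ i, Integrable (fun ω => |ξ i ω| ^ p) P) (hM : ∀ i, ∫ ω, |ξ i ω| ^ p ∂P ≤ M)
    {k m : ℕ} (hkm : k ≤ m) :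
    P.real {ω | x ≤ ∑ i ∈ Finset.range k, truncation (ξ i) T ω} ≤
      Real.exp (-t * x + m * (M * (t * T ^ (1 - p) + t ^ p * Real.exp (t * T)))) := by
  have htm : Measurable (Set.indicator (Set.Ioc (-T) T) id : ℝ → ℝ) :=
    measurable_id.indicator measurableSet_Ioc
  have hYm : ∀ i, Measurable (truncation (ξ i) T) := fun i => htm.comp (hmeas i)
  have hYind : iIndepFun (fun i => truncation (ξ i) T) P := hind.comp _ fun _ => htm
  have hM0 : 0 ≤ M := (integral_nonneg fun ω => by positivity).trans (hM 0)
  set K := M * (t * T ^ (1 - p) + t ^ p * Real.exp (t * T)) with hK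
  have hK0 : 0 ≤ K := by positivity
  have hbound : ∀ ω, |∑ i ∈ Finset.range k, truncation (ξ i) T ω| ≤ k * |T| := fun ω =>
    (Finset.abs_sum_le_sum_abs _ _).trans ((Finset.sum_le_card_nsmul _ _ _
      fun i _ => abs_truncation_le_bound _ _ _).trans_eq (by simp))
  have hexp : Integrable (fun ω => Real.exp (t * (∑ i ∈ Finset.range k, truncation (ξ i) T) ω))
      P := by
    refine Integrable.of_bound (C := Real.exp (t * (k * |T|))) ?_ (Eventually.of_forall fun ω => ?_)
    · simp only [Finset.sum_apply]
      exact (((Finset.measurable_sum _ fun i _ => hYm i).const_mul t).exp).aestronglyMeasurable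
    · rw [Real.norm_of_nonneg (Real.exp_pos _).le, Finset.sum_apply]
      gcongr
      exact (le_abs_self _).trans (hbound ω)
  have h1 := measure_ge_le_exp_mul_mgf (μ := P) (X := ∑ i ∈ Finset.range k, truncation (ξ i) T)
    x ht hexp
  rw [hYind.mgf_sum hYm] at h1
  simp only [Finset.sum_apply] at h1
  refine h1.trans ?_
  rw [Real.exp_add]
  gcongr
  calc ∏ i ∈ Finset.range k, mgf (truncation (ξ i) T) P t
      ≤ ∏ _i ∈ Finset.range k, Real.exp K :=
        Finset.prod_le_prod (fun i _ => mgf_nonneg) fun i _ =>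
          mgf_truncation_le hp1 hp2 hT ht (hξ i) (hmean i) (hξp i) (hM i)
    _ = Real.exp (k * K) := by simp [← Real.exp_nat_mul]
    _ ≤ Real.exp (m * K) := by gcongr

end Truncation

section MaximalDeviation

variable {d : ℕ} {Ω : Type*} [MeasurableSpace Ω] {P : Measure Ω} [IsProbabilityMeasure P]
  {X : ℕ → Ω → EuclideanSpace ℝ (Fin d)}

theorem exists_coord_of_lt_norm {x : ℝ} (hx : 0 ≤ x) {v : EuclideanSpace ℝ (Fin d)} (h : x < ‖v‖) :
    ∃ c, x / d ≤ |v c| := by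
  by_contra! hcon
  have h1 : ‖v‖ ≤ ∑ c, |v c| := by
    rw [EuclideanSpace.norm_eq]
    refine (Real.sqrt_le_left (Finset.sum_nonneg fun c _ => abs_nonneg _)).2 ?_
    simp only [Real.norm_eq_abs]
    exact Finset.sum_sq_le_sq_sum_of_nonneg fun c _ => abs_nonneg _
  rcases Nat.eq_zero_or_pos d with rfl | hd
  · rw [Finset.univ_eq_empty, Finset.sum_empty] at h1
    linarith
  · have h2 : ∑ c, |v c| ≤ ∑ _c : Fin d, x / d := Finset.sum_le_sum fun c _ => (hcon c).le
    have hd' : (d : ℝ) ≠ 0 := by positivity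
    simp only [Finset.sum_const, Finset.card_univ, Fintype.card_fin, nsmul_eq_mul] at h2
    rw [mul_div_cancel₀ _ hd'] at h2
    linarith

/-- A Fuk–Nagaev type inequality: apart from the event of a single large summand, the partial
sums are controlled by an exponential bound for the truncated coordinates. -/
theorem measure_exists_lt_norm_sum_le (hmeas : ∀ i, Measurable (X i)) (hindep : iIndepFun X P)
    (hident : ∀ i, IdentDistrib (X i) (X 0) P P) (hint : Integrable (X 0) P)
    (hmean : ∫ ω, X 0 ω ∂P = 0) {p : ℝ} (hp1 : 1 ≤ p) (hp2 : p ≤ 2)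
    (hmom : Integrable (fun ω => ‖X 0 ω‖ ^ p) P) {T t : ℝ} (hT : 0 < T) (ht : 0 ≤ t)
    (x : ℝ) (hx : 0 ≤ x) (m : ℕ) :
    P.real {ω | ∃ k ≤ m, x < ‖∑ i ∈ Finset.range k, X i ω‖} ≤
      m * P.real {ω | T / 2 < ‖X 0 ω‖} + (m + 1) * (2 * d) *
        Real.exp (-t * (x / d) + m * ((∫ ω, ‖X 0 ω‖ ^ p ∂P) *
          (t * T ^ (1 - p) + t ^ p * Real.exp (t * T)))) := by
  set M := ∫ ω, ‖X 0 ω‖ ^ p ∂P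
  -- The signed coordinates of the summands.
  let ξ : ℝ × Fin d → ℕ → Ω → ℝ := fun sc i ω => sc.1 * X i ω sc.2
  let I : Finset (ℝ × Fin d) := {1, -1} ×ˢ Finset.univ
  have hI : ∀ sc ∈ I, |sc.1| = 1 := by
    intro sc hsc
    have := (Finset.mem_product.1 hsc).1
    simp only [Finset.mem_insert, Finset.mem_singleton] at this
    rcases this with h | h <;> simp [h]
  have hIcard : (I.card : ℝ) = 2 * d := by
    rw [Finset.card_product, Finset.card_pair (by norm_num)]
    simp
  have hg : ∀ sc : ℝ × Fin d, Measurable fun y : EuclideanSpace ℝ (Fin d) => sc.1 * y sc.2 :=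
    fun sc => by fun_prop
  have hξle : ∀ sc ∈ I, ∀ i ω, |ξ sc i ω| ≤ ‖X i ω‖ := by
    intro sc hsc i ω
    simp only [ξ, abs_mul, hI sc hsc, one_mul]
    exact PiLp.norm_apply_le (X i ω) sc.2
  set R := Real.exp (-t * (x / d) + m * (M * (t * T ^ (1 - p) + t ^ p * Real.exp (t * T)))) with hR
  have hchern : ∀ sc ∈ I, ∀ k ≤ m,
      P.real {ω | x / d ≤ ∑ i ∈ Finset.range k, truncation (ξ sc i) T ω} ≤ R := by
    intro sc hsc k hk
    have hξm : ∀ i, Measurable (ξ sc i) := fun i => (hg sc).comp (hmeas i)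
    have hid : ∀ i, IdentDistrib (ξ sc i) (ξ sc 0) P P := fun i => (hident i).comp (hg sc)
    have hint0 : Integrable (ξ sc 0) P :=
      hint.norm.mono' (hξm 0).aestronglyMeasurable (Eventually.of_forall fun ω => hξle sc hsc 0 ω)
    have hmean0 : ∫ ω, ξ sc 0 ω ∂P = 0 := by
      have h1 := ((EuclideanSpace.proj sc.2 : EuclideanSpace ℝ (Fin d) →L[ℝ] ℝ)).integral_comp_comm
        hint
      rw [hmean, map_zero] at h1
      simp only [ξ, integral_const_mul]
      exact mul_eq_zero_of_right _ h1
    have hpm : Measurable fun y : ℝ => |y| ^ p := by fun_prop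
    have hintp0 : Integrable (fun ω => |ξ sc 0 ω| ^ p) P :=
      hmom.mono' (hpm.comp (hξm 0)).aestronglyMeasurable (Eventually.of_forall fun ω => by
        rw [Real.norm_of_nonneg (by positivity)]
        exact Real.rpow_le_rpow (abs_nonneg _) (hξle sc hsc 0 ω) (by linarith))
    have hM0 : ∫ ω, |ξ sc 0 ω| ^ p ∂P ≤ M := integral_mono hintp0 hmom fun ω =>
      Real.rpow_le_rpow (abs_nonneg _) (hξle sc hsc 0 ω) (by linarith)
    exact measure_truncated_sum_ge_le hp1 hp2 hT ht hξm (hindep.comp _ fun _ => hg sc)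
      (fun i => (hid i).integrable_iff.2 hint0) (fun i => (hid i).integral_eq.trans hmean0)
      (fun i => ((hid i).comp hpm).integrable_iff.2 hintp0)
      (fun i => ((hid i).comp hpm).integral_eq.trans_le hM0) hk
  have hsub : {ω | ∃ k ≤ m, x < ‖∑ i ∈ Finset.range k, X i ω‖} ⊆
      (⋃ i ∈ Finset.range m, {ω | T / 2 < ‖X i ω‖}) ∪
      ⋃ k ∈ Finset.range (m + 1), ⋃ sc ∈ I,
        {ω | x / d ≤ ∑ i ∈ Finset.range k, truncation (ξ sc i) T ω} := by
    rintro ω ⟨k, hk, hω⟩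
    by_cases hbig : ∃ i ∈ Finset.range m, T / 2 < ‖X i ω‖
    · obtain ⟨i, hi, hω'⟩ := hbig
      exact Or.inl (Set.mem_biUnion (Finset.mem_coe.2 hi) hω')
    · push Not at hbig
      refine Or.inr ?_
      obtain ⟨c, hc⟩ := exists_coord_of_lt_norm hx hω
      obtain ⟨s, hs, hsc⟩ : ∃ s ∈ ({1, -1} : Finset ℝ),
          x / d ≤ s * (∑ i ∈ Finset.range k, X i ω) c := by
        rcases le_abs.1 hc with h | h
        · exact ⟨1, by simp, by simpa using h⟩
        · exact ⟨-1, by simp, by simpa using h⟩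
      have hmem : (s, c) ∈ I := Finset.mem_product.2 ⟨hs, Finset.mem_univ _⟩
      refine Set.mem_biUnion (Finset.mem_coe.2 (Finset.mem_range.2 (Nat.lt_succ_of_le hk)))
        (Set.mem_biUnion (Finset.mem_coe.2 hmem) ?_)
      show x / d ≤ ∑ i ∈ Finset.range k, truncation (ξ (s, c) i) T ω
      refine hsc.trans_eq ?_
      rw [WithLp.ofLp_sum, Finset.sum_apply, Finset.mul_sum]
      refine Finset.sum_congr rfl fun i hi => (truncation_eq_self ?_).symm
      have hi' : i ∈ Finset.range m :=
        Finset.mem_range.2 ((Finset.mem_range.1 hi).trans_le hk)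
      linarith [hξle _ hmem i ω, hbig i hi']
  calc P.real {ω | ∃ k ≤ m, x < ‖∑ i ∈ Finset.range k, X i ω‖}
      ≤ P.real (⋃ i ∈ Finset.range m, {ω | T / 2 < ‖X i ω‖}) +
        P.real (⋃ k ∈ Finset.range (m + 1), ⋃ sc ∈ I,
          {ω | x / d ≤ ∑ i ∈ Finset.range k, truncation (ξ sc i) T ω}) :=
        (measureReal_mono hsub).trans (measureReal_union_le _ _)
    _ ≤ ∑ i ∈ Finset.range m, P.real {ω | T / 2 < ‖X i ω‖} +
        ∑ k ∈ Finset.range (m + 1), ∑ sc ∈ I, R := by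
        refine add_le_add (measureReal_biUnion_finset_le _ _) ?_
        refine (measureReal_biUnion_finset_le _ _).trans (Finset.sum_le_sum fun k hk => ?_)
        refine (measureReal_biUnion_finset_le _ _).trans (Finset.sum_le_sum fun sc hsc => ?_)
        exact hchern sc hsc k (Nat.lt_succ_iff.1 (Finset.mem_range.1 hk))
    _ = _ := by
        have h1 : ∀ i, P.real {ω | T / 2 < ‖X i ω‖} = P.real {ω | T / 2 < ‖X 0 ω‖} := by
          intro i
          have := (hident i).measure_mem_eq (measurableSet_norm_gt (d := d) (T / 2))
          exact congrArg ENNReal.toReal this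
        simp only [h1, Finset.sum_const, Finset.card_range, nsmul_eq_mul, hIcard]
        push_cast
        ring

theorem tendsto_log_rpow_mul_rpow_neg (r : ℝ) {s : ℝ} (hs : 0 < s) :
    Tendsto (fun x : ℝ => Real.log x ^ r * x ^ (-s)) atTop (𝓝 0) := by
  refine (isLittleO_log_rpow_rpow_atTop r hs).tendsto_div_nhds_zero.congr' ?_
  filter_upwards [eventually_gt_atTop 0] with x hx
  rw [Real.rpow_neg hx.le, div_eq_mul_inv]

/-- If the tail of the steps decays faster than `x ^ (-(q + 1))`, then the maximum of the first `m`
partial sums exceeds `δ m` with probability at most `m ^ (-q)`: up to smaller terms, this requires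
one of the `m` steps to be of order `m`. -/
theorem maximal_deviation (hd : 0 < d) (hmeas : ∀ i, Measurable (X i)) (hindep : iIndepFun X P)
    (hident : ∀ i, IdentDistrib (X i) (X 0) P P) (hint : Integrable (X 0) P)
    (hmean : ∫ ω, X 0 ω ∂P = 0) {p : ℝ} (hp1 : 1 < p) (hp2 : p ≤ 2)
    (hmom : Integrable (fun ω => ‖X 0 ω‖ ^ p) P) {C x₀ q r : ℝ}
    (htail : ∀ x, x₀ ≤ x → P.real {ω | x < ‖X 0 ω‖} ≤ C * x ^ (-r)) (hq : 0 < q)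
    (hqr : q + 1 < r) {δ : ℝ} (hδ : 0 < δ) :
    ∀ᶠ m : ℕ in atTop,
      P.real {ω | ∃ k ≤ m, δ * m < ‖∑ i ∈ Finset.range k, X i ω‖} ≤ (m : ℝ) ^ (-q) := by
  set M := ∫ ω, ‖X 0 ω‖ ^ p ∂P
  have hM : 0 ≤ M := integral_nonneg fun ω => by positivity
  have hd' : (0 : ℝ) < d := by exact_mod_cast hd
  -- With truncation level `γ m` and exponential parameter `c log m / m`, the exponential bound is
  -- of order `m ^ (-(q + 2))`, and `γ` is so small that the exponential moments stay bounded.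
  obtain ⟨c, hcdef⟩ : ∃ c : ℝ, c = (q + 2) * d / δ := ⟨_, rfl⟩
  have hc : 0 < c := by rw [hcdef]; positivity
  obtain ⟨γ, hγdef⟩ : ∃ γ : ℝ, γ = (p - 1) / (2 * c) := ⟨_, rfl⟩
  have hp0 : 0 < p - 1 := by linarith
  have hγ : 0 < γ := by rw [hγdef]; positivity
  have hF : Tendsto (fun x : ℝ => M * c * γ ^ (1 - p) * (Real.log x ^ (1 : ℝ) * x ^ (-(p - 1))) +
      M * c ^ p * (Real.log x ^ p * x ^ (-((p - 1) / 2)))) atTop (𝓝 0) := by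
    have := ((tendsto_log_rpow_mul_rpow_neg 1 hp0).const_mul (M * c * γ ^ (1 - p))).add
      ((tendsto_log_rpow_mul_rpow_neg p (half_pos hp0)).const_mul (M * c ^ p))
    simpa using this
  have hlarge : ∀ᶠ x : ℝ in atTop, 1 < x ∧ x₀ ≤ γ * x / 2 ∧
      (M * c * γ ^ (1 - p) * (Real.log x ^ (1 : ℝ) * x ^ (-(p - 1))) +
        M * c ^ p * (Real.log x ^ p * x ^ (-((p - 1) / 2)))) < 1 ∧
      2 * (C * (γ / 2) ^ (-r)) * x ^ (1 - r) ≤ x ^ (-q) ∧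
      2 * (4 * d * Real.exp 1) * x ^ (-(q + 1)) ≤ x ^ (-q) := by
    refine (eventually_gt_atTop 1).and (.and ?_ (.and ?_ (.and ?_ ?_)))
    · exact (Tendsto.atTop_div_const two_pos (tendsto_id.const_mul_atTop hγ)).eventually_ge_atTop x₀
    · exact hF.eventually_lt_const one_pos
    · exact eventually_const_mul_rpow_le _ (by linarith)
    · exact eventually_const_mul_rpow_le _ (by linarith)
  filter_upwards [tendsto_natCast_atTop_atTop.eventually hlarge] with m ⟨hm1, hmx, hmF, hmC, hmd⟩
  set x : ℝ := (m : ℝ)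
  have hx : 0 < x := by linarith
  have hlog : 0 < Real.log x := Real.log_pos hm1
  have hL : 0 ≤ c * Real.log x / x := by positivity
  refine (measure_exists_lt_norm_sum_le hmeas hindep hident hint hmean hp1.le hp2 hmom
    (mul_pos hγ hx) hL (δ * x) (by positivity) m).trans ?_
  have hexp : Real.exp (c * Real.log x / x * (γ * x)) = x ^ ((p - 1) / 2) := by
    rw [Real.rpow_def_of_pos hx]
    congr 1
    rw [hγdef]
    field_simp
  have hfirst : -(c * Real.log x / x) * (δ * x / d) = Real.log x * -(q + 2) := by
    rw [hcdef]
    field_simp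
  have hsecond : x * (M * (c * Real.log x / x * (γ * x) ^ (1 - p) +
      (c * Real.log x / x) ^ p * Real.exp (c * Real.log x / x * (γ * x)))) < 1 := by
    refine lt_of_eq_of_lt ?_ hmF
    rw [hexp, Real.mul_rpow hγ.le hx.le, Real.div_rpow (by positivity) hx.le,
      Real.mul_rpow hc.le hlog.le, Real.rpow_one]
    have h1 : x ^ (1 - p) = x ^ (-(p - 1)) := by congr 1; ring
    have h2 : x ^ (-((p - 1) / 2)) = x * (x ^ ((p - 1) / 2) / x ^ p) := by
      rw [← Real.rpow_sub hx, ← Real.rpow_one_add' hx.le (by linarith)]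
      congr 1
      ring
    rw [h1, h2]
    field_simp
  have htl := htail (γ * x / 2) hmx
  have h3 : x * P.real {ω | γ * x / 2 < ‖X 0 ω‖} ≤ C * (γ / 2) ^ (-r) * x ^ (1 - r) := by
    calc x * P.real {ω | γ * x / 2 < ‖X 0 ω‖} ≤ x * (C * (γ * x / 2) ^ (-r)) := by gcongr
      _ = C * (γ / 2) ^ (-r) * x ^ (1 - r) := by
        rw [show γ * x / 2 = γ / 2 * x by ring, Real.mul_rpow (by positivity) hx.le,
          sub_eq_add_neg, Real.rpow_add hx, Real.rpow_one]
        ring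
  have h4 : (x + 1) * (2 * d) * Real.exp (-(c * Real.log x / x) * (δ * x / d) +
      x * (M * (c * Real.log x / x * (γ * x) ^ (1 - p) +
      (c * Real.log x / x) ^ p * Real.exp (c * Real.log x / x * (γ * x))))) ≤
      4 * d * Real.exp 1 * x ^ (-(q + 1)) := by
    rw [Real.exp_add, hfirst, ← Real.rpow_def_of_pos hx]
    have h5 : x * x ^ (-(q + 2)) = x ^ (-(q + 1)) := by
      rw [← Real.rpow_one_add' hx.le (by linarith)]
      congr 1
      ring
    calc _ ≤ (2 * x) * (2 * d) * (x ^ (-(q + 2)) * Real.exp 1) := by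
          gcongr
          linarith
      _ = _ := by rw [← h5]; ring
  linarith

end MaximalDeviation

/-! ### Past and future of an i.i.d. sequence -/

section Future

variable {E : Type*} [mE : MeasurableSpace E] {Ω : Type*}

/-- The σ-algebra generated by the first `t` members of a sequence of random variables. -/
@[reducible] def pastSigma (X : ℕ → Ω → E) (t : ℕ) : MeasurableSpace Ω :=
  ⨆ i ∈ Set.Iio t, mE.comap (X i)

theorem measurable_pastSigma (X : ℕ → Ω → E) {i t : ℕ} (hit : i < t) :
    Measurable[pastSigma X t] (X i) := by
  refine measurable_iff_comap_le.2 ?_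
  exact le_iSup₂_of_le i hit le_rfl

theorem pastSigma_mono (X : ℕ → Ω → E) {s t : ℕ} (hst : s ≤ t) :
    pastSigma X s ≤ pastSigma X t :=
  iSup₂_le fun i hi => le_iSup₂_of_le (f := fun i (_ : i ∈ Set.Iio t) => mE.comap (X i)) i
    (lt_of_lt_of_le hi hst) le_rfl

theorem measurable_tuple {m : MeasurableSpace Ω} {f : ℕ → Ω → E} (hf : ∀ k, Measurable[m] (f k)) :
    Measurable[m] fun ω k => f k ω :=
  measurable_pi_iff.2 hf

/-- A condition on the members of a sequence with indices in `[s, t)` is an event of the past of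
`t`. -/
theorem measurableSet_pastSigma_shift (X : ℕ → Ω → E) {s t m : ℕ} (hst : s + m ≤ t)
    {G : Set (ℕ → E)} (hG : MeasurableSet G)
    (hdep : ∀ y z : ℕ → E, (∀ i < m, y i = z i) → y ∈ G → z ∈ G) (e : E) :
    MeasurableSet[pastSigma X t] {ω | (fun k => X (s + k) ω) ∈ G} := by
  have h1 : {ω | (fun k => X (s + k) ω) ∈ G} =
      (fun ω k => if k < m then X (s + k) ω else e) ⁻¹' G := by
    ext ω
    refine ⟨hdep _ _ fun i hi => by simp [hi], hdep _ _ fun i hi => by simp [hi]⟩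
  rw [h1]
  refine measurable_tuple (m := pastSigma X t) (f := fun k ω => if k < m then X (s + k) ω else e)
    (fun k => ?_) hG
  split_ifs with hk
  · exact measurable_pastSigma X (by omega)
  · exact measurable_const

variable [MeasurableSpace Ω] {P : Measure Ω} {X : ℕ → Ω → E}

/-- Stationarity: the future from time `t` on is distributed like the whole sequence. -/
theorem measure_shift_eq (hindep : iIndepFun X P)
    (hident : ∀ i, IdentDistrib (X i) (X 0) P P) (t : ℕ) {G : Set (ℕ → E)}
    (hG : MeasurableSet G) :
    P {ω | (fun k => X (t + k) ω) ∈ G} = P {ω | (fun k => X k ω) ∈ G} := by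
  have h := IdentDistrib.pi (fun k => (hident (t + k)).trans (hident k).symm)
    (hindep.precomp (add_right_injective t)) hindep
  exact h.measure_mem_eq hG

/-- Events of the past up to time `t` are independent of the future, which starts afresh. -/
theorem measure_inter_shift_eq (hmeas : ∀ i, Measurable (X i)) (hindep : iIndepFun X P)
    (hident : ∀ i, IdentDistrib (X i) (X 0) P P) {t : ℕ} {F : Set Ω}
    (hF : MeasurableSet[pastSigma X t] F) {G : Set (ℕ → E)} (hG : MeasurableSet G) :
    P (F ∩ {ω | (fun k => X (t + k) ω) ∈ G}) = P F * P {ω | (fun k => X k ω) ∈ G} := by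
  have hdisj : Disjoint (Set.Iio t) (Set.Ici t) :=
    Set.disjoint_left.2 fun i hi hi' =>
      not_lt.2 (Set.mem_Ici.1 hi') (Set.mem_Iio.1 hi)
  have hind := indep_iSup_of_disjoint (fun i => (hmeas i).comap_le)
    ((iIndepFun_iff_iIndep _ _ _).1 hindep) hdisj
  have hfut : MeasurableSet[⨆ i ∈ Set.Ici t, mE.comap (X i)]
      {ω | (fun k => X (t + k) ω) ∈ G} := by
    refine measurable_tuple (f := fun k ω => X (t + k) ω) (fun k => ?_) hG
    refine measurable_iff_comap_le.2 ?_
    exact le_iSup₂_of_le (f := fun i (_ : i ∈ Set.Ici t) => mE.comap (X i)) (t + k)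
      (Nat.le_add_right t k) le_rfl
  rw [(Indep_iff _ _ _).1 hind F _ hF hfut, measure_shift_eq hindep hident t hG]

theorem measureReal_inter_shift_eq (hmeas : ∀ i, Measurable (X i)) (hindep : iIndepFun X P)
    (hident : ∀ i, IdentDistrib (X i) (X 0) P P) {t : ℕ} {F : Set Ω}
    (hF : MeasurableSet[pastSigma X t] F) {G : Set (ℕ → E)} (hG : MeasurableSet G) :
    P.real (F ∩ {ω | (fun k => X (t + k) ω) ∈ G}) =
      P.real F * P.real {ω | (fun k => X k ω) ∈ G} := by
  simp only [Measure.real, measure_inter_shift_eq hmeas hindep hident hF hG, ENNReal.toReal_mul]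

end Future

/-! ### Radial geometry of a compact convex set off the origin -/

section Geometry

variable {d : ℕ} {A : Set (EuclideanSpace ℝ (Fin d))}

theorem norm_inv_norm_smul {x : EuclideanSpace ℝ (Fin d)} (hx : x ≠ 0) : ‖‖x‖⁻¹ • x‖ = 1 := by
  rw [norm_smul, norm_inv, norm_norm, inv_mul_cancel₀ (norm_ne_zero_iff.2 hx)]

theorem exists_norm_bounds (hA : IsCompact A) (h0 : 0 ∉ A) :
    ∃ ε R : ℝ, 0 < ε ∧ 0 < R ∧ ∀ x ∈ A, ε ≤ ‖x‖ ∧ ‖x‖ ≤ R := by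
  obtain ⟨R, hR⟩ := hA.isBounded.exists_norm_le
  have hopen : Aᶜ ∈ 𝓝 (0 : EuclideanSpace ℝ (Fin d)) := hA.isClosed.isOpen_compl.mem_nhds h0
  obtain ⟨ε, hε, hball⟩ := Metric.mem_nhds_iff.1 hopen
  refine ⟨ε, max R 1, hε, by positivity, fun x hx => ⟨?_, (hR x hx).trans (le_max_left _ _)⟩⟩
  by_contra! hlt
  exact hball (by simpa using hlt) hx

/-- The points of `A` on the line through the origin in the direction of a point of `A` all lie
on the same side of the origin, by convexity. -/
theorem pos_of_smul_mem (hconv : Convex ℝ A) (h0 : 0 ∉ A) {x : EuclideanSpace ℝ (Fin d)}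
    (hx : x ∈ A) {r : ℝ} (hr : r • (‖x‖⁻¹ • x) ∈ A) : 0 < r := by
  have hx0 : x ≠ 0 := fun h => h0 (h ▸ hx)
  have hn : 0 < ‖x‖ := norm_pos_iff.2 hx0
  by_contra! hcon
  refine h0 ?_
  have hs : 0 < ‖x‖ - r := by linarith
  have := hconv hx hr (a := -r / (‖x‖ - r)) (b := ‖x‖ / (‖x‖ - r)) (by
    apply div_nonneg <;> linarith) (by positivity) (by field_simp; ring)
  convert this using 1
  rw [smul_smul, smul_smul, ← add_smul]
  have h1 : -r / (‖x‖ - r) + ‖x‖ / (‖x‖ - r) * r * ‖x‖⁻¹ = 0 := by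
    field_simp
    ring
  rw [h1, zero_smul]

theorem ray_bounds (hconv : Convex ℝ A) (h0 : 0 ∉ A) {ε R : ℝ}
    (hb : ∀ x ∈ A, ε ≤ ‖x‖ ∧ ‖x‖ ≤ R) {x : EuclideanSpace ℝ (Fin d)}
    (hx : x ∈ A) {r : ℝ} (hr : r • (‖x‖⁻¹ • x) ∈ A) : ε ≤ r ∧ r ≤ R := by
  have hpos := pos_of_smul_mem hconv h0 hx hr
  have := hb _ hr
  rwa [norm_smul, norm_inv_norm_smul (fun h => h0 (h ▸ hx)), mul_one,
    Real.norm_of_nonneg hpos.le] at this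

theorem norm_mem_ray {x : EuclideanSpace ℝ (Fin d)} (hx0 : x ≠ 0) {s : ℝ} (hx : s • x ∈ A) :
    s * ‖x‖ ∈ {r : ℝ | r • (‖x‖⁻¹ • x) ∈ A} := by
  show (s * ‖x‖) • (‖x‖⁻¹ • x) ∈ A
  rwa [smul_smul, mul_assoc, mul_inv_cancel₀ (norm_ne_zero_iff.2 hx0), mul_one]

theorem isClosed_ray (hA : IsCompact A) (φ : EuclideanSpace ℝ (Fin d)) :
    IsClosed {r : ℝ | r • φ ∈ A} :=
  hA.isClosed.preimage (by fun_prop : Continuous fun r : ℝ => r • φ)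

/-- The entry and exit radii in a direction of `A` are attained and enclose the ray in `A`. -/
theorem radii_spec (hA : IsCompact A) (hconv : Convex ℝ A) (h0 : 0 ∉ A)
    {x : EuclideanSpace ℝ (Fin d)} (hx : x ∈ A) :
    exitRadius A (‖x‖⁻¹ • x) • (‖x‖⁻¹ • x) ∈ A ∧ entryRadius A (‖x‖⁻¹ • x) • (‖x‖⁻¹ • x) ∈ A ∧
      ∀ s : ℝ, s • x ∈ A → entryRadius A (‖x‖⁻¹ • x) ≤ s * ‖x‖ ∧
        s * ‖x‖ ≤ exitRadius A (‖x‖⁻¹ • x) := by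
  obtain ⟨ε, R, -, -, hb⟩ := exists_norm_bounds hA h0
  have hx0 : x ≠ 0 := fun h => h0 (h ▸ hx)
  have hne : {r : ℝ | r • (‖x‖⁻¹ • x) ∈ A}.Nonempty :=
    ⟨1 * ‖x‖, norm_mem_ray hx0 (by rwa [one_smul])⟩
  have hbb : BddBelow {r : ℝ | r • (‖x‖⁻¹ • x) ∈ A} := ⟨ε, fun r hr =>
    (ray_bounds hconv h0 hb hx hr).1⟩
  have hba : BddAbove {r : ℝ | r • (‖x‖⁻¹ • x) ∈ A} := ⟨R, fun r hr =>
    (ray_bounds hconv h0 hb hx hr).2⟩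
  exact ⟨(isClosed_ray hA _).csSup_mem hne hba, (isClosed_ray hA _).csInf_mem hne hbb,
    fun s hs => ⟨csInf_le hbb (norm_mem_ray hx0 hs), le_csSup hba (norm_mem_ray hx0 hs)⟩⟩

theorem bddAbove_radii_ratio (hA : IsCompact A) (hconv : Convex ℝ A) (h0 : 0 ∉ A) :
    BddAbove ((fun φ => exitRadius A φ / entryRadius A φ) '' directions A) := by
  obtain ⟨ε, R, hε, hR, hb⟩ := exists_norm_bounds hA h0
  refine ⟨R / ε, ?_⟩
  rintro _ ⟨_, ⟨x, hx, rfl⟩, rfl⟩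
  obtain ⟨h1, h2, -⟩ := radii_spec hA hconv h0 hx
  exact div_le_div₀ hR.le (ray_bounds hconv h0 hb hx h1).2 hε (ray_bounds hconv h0 hb hx h2).1

/-- Points of `A` on a common ray have a ratio of at most `r*`. -/
theorem inv_le_rStar (hA : IsCompact A) (hconv : Convex ℝ A) (h0 : 0 ∉ A)
    {x : EuclideanSpace ℝ (Fin d)} (hx : x ∈ A) {s : ℝ} (hs : 0 < s) (hsx : s • x ∈ A) :
    s⁻¹ ≤ rStar A := by
  obtain ⟨h1, h2, h3⟩ := radii_spec hA hconv h0 hx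
  have hn : 0 < ‖x‖ := norm_pos_iff.2 fun h => h0 (h ▸ hx)
  have hL := pos_of_smul_mem hconv h0 hx h2
  have hLs := (h3 s hsx).1
  have hU := (h3 1 (by rwa [one_smul])).2
  refine le_trans ?_ (le_csSup (bddAbove_radii_ratio hA hconv h0) ⟨_, ⟨x, hx, rfl⟩, rfl⟩)
  show s⁻¹ ≤ exitRadius A (‖x‖⁻¹ • x) / entryRadius A (‖x‖⁻¹ • x)
  rw [inv_eq_one_div, div_le_div_iff₀ hs hL]
  nlinarith

theorem exists_smul_mem_of_lt_rStar (hA : IsCompact A) (hconv : Convex ℝ A) (h0 : 0 ∉ A)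
    (hne : A.Nonempty) {r : ℝ} (hr : r < rStar A) :
    ∃ x ∈ A, ∃ s : ℝ, r < s ∧ 0 < s ∧ s⁻¹ • x ∈ A := by
  obtain ⟨_, ⟨_, ⟨x, hx, rfl⟩, rfl⟩, hlt⟩ := exists_lt_of_lt_csSup ((hne.image _).image _) hr
  obtain ⟨h1, h2, h3⟩ := radii_spec hA hconv h0 hx
  have hL := pos_of_smul_mem hconv h0 hx h2
  have hU := pos_of_smul_mem hconv h0 hx h1
  refine ⟨_, h1, _, hlt, div_pos hU hL, ?_⟩
  show (exitRadius A (‖x‖⁻¹ • x) / entryRadius A (‖x‖⁻¹ • x))⁻¹ •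
    exitRadius A (‖x‖⁻¹ • x) • (‖x‖⁻¹ • x) ∈ A
  rw [smul_smul, inv_div, div_mul_cancel₀ _ hU.ne']
  exact h2

theorem one_lt_rStar (hA : IsCompact A) (hconv : Convex ℝ A) (h0 : 0 ∉ A)
    (hint : (interior A).Nonempty) : 1 < rStar A := by
  obtain ⟨x, hx⟩ := hint
  have hcont : ContinuousAt (fun s : ℝ => s • x) 1 := by fun_prop
  have hmem : ∀ᶠ s in 𝓝 (1 : ℝ), s • x ∈ A := by
    refine hcont.eventually_mem ?_
    rw [one_smul]
    exact mem_interior_iff_mem_nhds.1 hx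
  obtain ⟨s, ⟨hs, hs0⟩, hs1⟩ := ((hmem.and (eventually_gt_nhds one_pos)).filter_mono
    nhdsWithin_le_nhds |>.and (self_mem_nhdsWithin (s := Set.Iio (1 : ℝ)))).exists
  exact (one_lt_inv₀ hs0).2 hs1 |>.trans_le
    (inv_le_rStar hA hconv h0 (interior_subset hx) hs0 hs)

/-- Shrinking `A` by a factor of more than `r*` moves it a positive distance away from `A`. -/
theorem exists_separation (hA : IsCompact A) (hconv : Convex ℝ A) (h0 : 0 ∉ A) {r : ℝ}
    (hr0 : 0 < r) (hr : rStar A < r) :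
    ∃ δ > 0, ∀ x ∈ A, ∀ y ∈ A, ∀ s : ℝ, 0 ≤ s → s ≤ r⁻¹ → δ ≤ ‖x - s • y‖ := by
  rcases A.eq_empty_or_nonempty with rfl | hne
  · exact ⟨1, one_pos, fun x hx => absurd hx (Set.notMem_empty x)⟩
  have hK : IsCompact (A ×ˢ A ×ˢ Set.Icc (0 : ℝ) r⁻¹) := hA.prod (hA.prod isCompact_Icc)
  have hKne : (A ×ˢ A ×ˢ Set.Icc (0 : ℝ) r⁻¹).Nonempty :=
    hne.prod (hne.prod ⟨0, le_rfl, by positivity⟩)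
  have hcont : Continuous fun z : EuclideanSpace ℝ (Fin d) × EuclideanSpace ℝ (Fin d) × ℝ =>
      ‖z.1 - z.2.2 • z.2.1‖ := by fun_prop
  obtain ⟨⟨x, y, s⟩, hmem, hmin⟩ := hK.exists_isMinOn hKne hcont.continuousOn
  obtain ⟨hx, hy, hs⟩ : x ∈ A ∧ y ∈ A ∧ s ∈ Set.Icc (0 : ℝ) r⁻¹ := by
    simpa only [Set.mem_prod] using hmem
  refine ⟨‖x - s • y‖, norm_pos_iff.2 fun h => ?_, fun x' hx' y' hy' s' h1 h2 =>
    isMinOn_iff.1 hmin (x', y', s') (Set.mk_mem_prod hx' (Set.mk_mem_prod hy' ⟨h1, h2⟩))⟩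
  have hxy : x = s • y := sub_eq_zero.1 h
  have hs0 : 0 < s := lt_of_le_of_ne hs.1 fun h => h0 (by
    have := hx
    rwa [hxy, ← h, zero_smul] at this)
  have h1 := inv_le_rStar hA hconv h0 hy hs0 (hxy ▸ hx)
  have h2 : r ≤ s⁻¹ := (le_inv_comm₀ hs0 hr0).1 hs.2
  linarith

/-- For `1 < r < r*` some interior point of `A` stays in the interior when divided by `r`. -/
theorem exists_interior_ray (hA : IsCompact A) (hconv : Convex ℝ A) (h0 : 0 ∉ A)
    (hint : (interior A).Nonempty) {r : ℝ} (hr1 : 1 < r) (hr : r < rStar A) :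
    ∃ w, w ∈ interior A ∧ r⁻¹ • w ∈ interior A := by
  obtain ⟨x, hx, s, hrs, hs0, hsx⟩ :=
    exists_smul_mem_of_lt_rStar hA hconv h0 (hint.mono interior_subset) hr
  obtain ⟨z, hz⟩ := hint
  -- The point `w = (1 - ε) x + ε z`, divided by `r`, is a convex combination of `z` and the point
  -- `c x` with `c = (1 - ε) / (r - ε)`, which is at least `1 / s` for this choice of `ε`.
  obtain ⟨ε, hε0, hε1, hε2⟩ : ∃ ε : ℝ, 0 < ε ∧ ε < 1 ∧ r - ε ≤ (1 - ε) * s := by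
    refine ⟨(s - r) / s, by positivity [sub_pos.2 hrs], by rw [div_lt_one hs0]; linarith, ?_⟩
    have : (1 - (s - r) / s) * s = r := by field_simp; ring
    rw [this]
    have : 0 < (s - r) / s := div_pos (by linarith) hs0
    linarith
  have hrε : 0 < r - ε := by linarith
  have hc1 : (1 - ε) / (r - ε) ≤ 1 := (div_le_one hrε).2 (by linarith)
  have hc2 : s⁻¹ ≤ (1 - ε) / (r - ε) := by
    rw [inv_eq_one_div, div_le_div_iff₀ hs0 hrε]; linarith
  have hcx : ((1 - ε) / (r - ε)) • x ∈ A := by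
    have h1 : (1 - ε) / (r - ε) ∈ segment ℝ s⁻¹ 1 := by
      rw [segment_eq_Icc (hc2.trans hc1)]
      exact ⟨hc2, hc1⟩
    obtain ⟨a, b, ha, hb, hab, heq⟩ := h1
    have := hconv hsx hx ha hb hab
    rwa [smul_smul, ← add_smul, show a * s⁻¹ + b = (1 - ε) / (r - ε) by simpa using heq] at this
  refine ⟨(1 - ε) • x + ε • z, hconv.combo_self_interior_mem_interior hx hz (by linarith) hε0
    (by ring), ?_⟩
  have := hconv.combo_self_interior_mem_interior hcx hz (a := 1 - ε / r) (b := ε / r)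
    (by rw [sub_nonneg, div_le_one (by linarith)]; linarith) (by positivity) (by ring)
  convert this using 1
  rw [smul_add, smul_smul, smul_smul, smul_smul]
  congr 2
  · field_simp
  · field_simp

end Geometry

/-! ### The upper bound -/

section UpperBound

variable {d : ℕ} {Ω : Type*} {X : ℕ → Ω → EuclideanSpace ℝ (Fin d)}
  {A : Set (EuclideanSpace ℝ (Fin d))}

/-- The sum of the `m` steps following the first `s` ones. -/
theorem sum_range_shift (X : ℕ → Ω → EuclideanSpace ℝ (Fin d)) (s m : ℕ) (ω : Ω) :
    ∑ i ∈ Finset.range m, X (s + i) ω =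
      ∑ i ∈ Finset.range (s + m), X i ω - ∑ i ∈ Finset.range s, X i ω := by
  rw [Finset.sum_range_add, add_sub_cancel_left]

theorem measurable_sum_range (m : ℕ) :
    Measurable fun y : ℕ → EuclideanSpace ℝ (Fin d) => ∑ i ∈ Finset.range m, y i :=
  Finset.measurable_sum _ fun i _ => measurable_pi_apply i

/-- The event that in each of the blocks `(t j, t (j + 1)]`, `j₀ ≤ j < J`, the walk moves by at
least `δ t (j + 1)`. -/
def blockMoves (X : ℕ → Ω → EuclideanSpace ℝ (Fin d)) (t : ℕ → ℕ) (δ : ℝ) (j₀ J : ℕ) : Set Ω :=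
  {ω | ∀ j, j₀ ≤ j → j < J → δ * t (j + 1) ≤ ‖∑ i ∈ Finset.range (t (j + 1) - t j), X (t j + i) ω‖}

theorem blockMoves_succ {t : ℕ → ℕ} {δ : ℝ} {j₀ J : ℕ} (hJ : j₀ ≤ J) :
    blockMoves X t δ j₀ (J + 1) = blockMoves X t δ j₀ J ∩ {ω | (fun k => X (t J + k) ω) ∈
      {y : ℕ → EuclideanSpace ℝ (Fin d) |
        δ * t (J + 1) ≤ ‖∑ i ∈ Finset.range (t (J + 1) - t J), y i‖}} := by
  ext ω
  constructor
  · intro h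
    exact ⟨fun j h1 h2 => h j h1 (by omega), h J hJ (by omega)⟩
  · rintro ⟨h, h'⟩ j h1 h2
    rcases Nat.lt_succ_iff_lt_or_eq.1 h2 with h3 | rfl
    · exact h j h1 h3
    · exact h'

theorem measurableSet_blockMove (m : ℕ) (c : ℝ) :
    MeasurableSet {y : ℕ → EuclideanSpace ℝ (Fin d) | c ≤ ‖∑ i ∈ Finset.range m, y i‖} :=
  measurableSet_le measurable_const (measurable_sum_range m).norm

theorem measurableSet_blockMoves {t : ℕ → ℕ} (ht : Monotone t) {δ : ℝ} {j₀ J : ℕ} (hJ : j₀ ≤ J) :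
    MeasurableSet[pastSigma X (t J)] (blockMoves X t δ j₀ J) := by
  induction J, hJ using Nat.le_induction with
  | base =>
    have : blockMoves X t δ j₀ j₀ = Set.univ :=
      Set.eq_univ_of_forall fun ω j h1 h2 => absurd h1 (not_le.2 h2)
    rw [this]
    exact MeasurableSet.univ
  | succ J hJ ih =>
    rw [blockMoves_succ hJ]
    have hmono : t J ≤ t (J + 1) := ht (Nat.le_succ J)
    refine MeasurableSet.inter (pastSigma_mono X hmono _ ih) ?_
    refine measurableSet_pastSigma_shift X (m := t (J + 1) - t J) (by omega)
      (measurableSet_blockMove _ _) (fun y z hyz hy => ?_) 0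
    have hsum : ∑ i ∈ Finset.range (t (J + 1) - t J), z i =
        ∑ i ∈ Finset.range (t (J + 1) - t J), y i :=
      Finset.sum_congr rfl fun i hi => (hyz i (Finset.mem_range.1 hi)).symm
    show δ * t (J + 1) ≤ ‖∑ i ∈ Finset.range (t (J + 1) - t J), z i‖
    rw [hsum]
    exact hy

/-- A walk whose averages stay in `A` moves by an amount of the order of time in every block
whose ends have a ratio of more than `r*`. -/
theorem persistenceEvent_subset_blockMoves {t : ℕ → ℕ} (ht : Monotone t) {δ s : ℝ} {j₀ J n : ℕ}
    (hsep : ∀ x ∈ A, ∀ y ∈ A, ∀ u : ℝ, 0 ≤ u → u ≤ s → δ ≤ ‖x - u • y‖)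
    (hpos : ∀ j, j₀ ≤ j → 0 < t j) (hratio : ∀ j, j₀ ≤ j → (t j : ℝ) / t (j + 1) ≤ s)
    (hn : t J ≤ n) : persistenceEvent X A n ⊆ blockMoves X t δ j₀ J := by
  intro ω hω j hj hjJ
  have h1 := hpos j hj
  have h2 := hpos (j + 1) (by omega)
  have h12 := ht (Nat.le_succ j)
  have h3 : t (j + 1) ≤ n := (ht (Nat.succ_le_of_lt hjJ)).trans hn
  have h4 := hsep _ (hω (t (j + 1)) h2 h3) _ (hω (t j) h1 (h12.trans h3)) _ (by positivity)
    (hratio j hj)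
  have h1' : (t j : ℝ) ≠ 0 := by exact_mod_cast h1.ne'
  have h2' : (0 : ℝ) < t (j + 1) := by exact_mod_cast h2
  rw [sum_range_shift, Nat.add_sub_cancel' h12]
  rw [smul_smul, div_mul_eq_mul_div, mul_inv_cancel₀ h1', one_div, ← smul_sub, norm_smul, norm_inv,
    Real.norm_of_nonneg h2'.le, le_inv_mul_iff₀ h2'] at h4
  linarith

theorem monotone_natCeil_pow {r : ℝ} (hr : 1 ≤ r) : Monotone fun j : ℕ => ⌈r ^ j⌉₊ :=
  fun _ _ h => Nat.ceil_mono (pow_le_pow_right₀ hr h)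

theorem eventually_natCeil_pow_ratio {r r' : ℝ} (hr' : 0 < r') (hr1 : 1 < r) (h : r' < r) :
    ∀ᶠ j : ℕ in atTop, ((⌈r ^ j⌉₊ : ℕ) : ℝ) / (⌈r ^ (j + 1)⌉₊ : ℕ) ≤ r'⁻¹ := by
  filter_upwards [(tendsto_pow_atTop_atTop_of_one_lt hr1).eventually_ge_atTop (r' / (r - r'))]
    with j hj
  have hpos : 0 < r ^ (j + 1) := by positivity
  have h1 : r ^ (j + 1) ≤ (⌈r ^ (j + 1)⌉₊ : ℕ) := Nat.le_ceil _
  have h2 : ((⌈r ^ j⌉₊ : ℕ) : ℝ) < r ^ j + 1 := Nat.ceil_lt_add_one (by positivity)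
  rw [div_le_iff₀ (by linarith), inv_mul_eq_div, le_div_iff₀ hr']
  rw [div_le_iff₀ (by linarith)] at hj
  calc ((⌈r ^ j⌉₊ : ℕ) : ℝ) * r' ≤ (r ^ j + 1) * r' := by gcongr
    _ ≤ r ^ (j + 1) := by rw [pow_succ]; linarith
    _ ≤ _ := h1

theorem rpow_neg_le_exp_of_pow_le {r q x : ℝ} (hr : 0 < r) (hq : 0 ≤ q) {j : ℕ} (hx : r ^ j ≤ x) :
    x ^ (-q) ≤ Real.exp (-(q * Real.log r * j)) := by
  calc x ^ (-q) ≤ (r ^ j) ^ (-q) :=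
        Real.rpow_le_rpow_of_nonpos (by positivity) hx (by linarith)
    _ = Real.exp (-(q * Real.log r * j)) := by
        rw [Real.rpow_def_of_pos (by positivity), Real.log_pow]
        congr 1
        ring

variable [MeasurableSpace Ω] {P : Measure Ω} [IsProbabilityMeasure P]

/-- The upper bound: in each of the independent blocks between the times `r ^ j`, where `r > r*`,
the walk has to move by an amount of the order of time, which has probability at most
`r ^ (-q j)`. -/
theorem persistence_upper_bound (hmeas : ∀ i, Measurable (X i)) (hindep : iIndepFun X P)
    (hident : ∀ i, IdentDistrib (X i) (X 0) P P) (hA : IsCompact A) (hconv : Convex ℝ A)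
    (h0 : 0 ∉ A) {q r : ℝ} (hq : 0 < q) (hr1 : 1 < r) (hr : rStar A < r)
    (hdev : ∀ δ : ℝ, 0 < δ → ∀ᶠ m : ℕ in atTop,
      P.real {ω | ∃ k ≤ m, δ * m < ‖∑ i ∈ Finset.range k, X i ω‖} ≤ (m : ℝ) ^ (-q)) :
    ∃ C : ℝ, ∀ᶠ n : ℕ in atTop, P.real (persistenceEvent X A n) ≤
      Real.exp (C - q * Real.log r * ((⌊Real.log n / Real.log r⌋₊ : ℝ) *
        (⌊Real.log n / Real.log r⌋₊ + 1) / 2)) := by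
  obtain ⟨r', hr', hr'r⟩ := exists_between (max_lt hr hr1)
  have hr'1 : 1 < r' := (le_max_right _ _).trans_lt hr'
  have hr'0 : 0 < r' := by linarith
  have hlogr : 0 < Real.log r := Real.log_pos hr1
  obtain ⟨δ, hδ, hsep⟩ := exists_separation hA hconv h0 hr'0 ((le_max_left _ _).trans_lt hr')
  obtain ⟨t, ht⟩ : ∃ t : ℕ → ℕ, t = fun j => ⌈r ^ j⌉₊ := ⟨_, rfl⟩
  have htmono : Monotone t := ht ▸ monotone_natCeil_pow hr1.le
  have htle : ∀ j, r ^ j ≤ t j := fun j => by rw [ht]; exact Nat.le_ceil _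
  have htpos : ∀ j, 0 < t j := fun j => by
    have : (0 : ℝ) < t j := (by positivity : (0 : ℝ) < r ^ j).trans_le (htle j)
    exact_mod_cast this
  have htop : Tendsto t atTop atTop :=
    tendsto_natCast_atTop_iff.1 (tendsto_atTop_mono htle (tendsto_pow_atTop_atTop_of_one_lt hr1))
  have hratio := eventually_natCeil_pow_ratio hr'0 hr1 hr'r
  have hdev' := (htop.comp (tendsto_add_atTop_nat 1)).eventually (hdev (δ / 2) (half_pos hδ))
  obtain ⟨j₀, hj₀⟩ := eventually_atTop.1 (hratio.and hdev')
  set a := q * Real.log r with ha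
  have hblock : ∀ J, j₀ ≤ J → P.real (blockMoves X t δ j₀ J) ≤
      Real.exp (a * (j₀ * (j₀ + 1) / 2) - a * (J * (J + 1) / 2)) := by
    intro J hJ
    induction J, hJ using Nat.le_induction with
    | base => rw [sub_self, Real.exp_zero]; exact measureReal_le_one
    | succ J hJ ih =>
      rw [blockMoves_succ hJ, measureReal_inter_shift_eq hmeas hindep hident
        (measurableSet_blockMoves htmono hJ) (measurableSet_blockMove _ _)]
      have h1 : P.real {ω | (fun k => X k ω) ∈ {y : ℕ → EuclideanSpace ℝ (Fin d) |
          δ * t (J + 1) ≤ ‖∑ i ∈ Finset.range (t (J + 1) - t J), y i‖}} ≤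
          Real.exp (-(a * ((J + 1 : ℕ) : ℝ))) := by
        refine le_trans (measureReal_mono fun ω hω => ?_) ((hj₀ J hJ).2.trans
          (rpow_neg_le_exp_of_pow_le (by linarith) hq.le (htle (J + 1))))
        refine ⟨t (J + 1) - t J, Nat.sub_le _ _, ?_⟩
        have h2 : δ * t (J + 1) ≤ ‖∑ i ∈ Finset.range (t (J + 1) - t J), X i ω‖ := hω
        have h3 : (0 : ℝ) < t (J + 1) := by exact_mod_cast htpos (J + 1)
        have h4 : 0 < δ * t (J + 1) := by positivity
        show δ / 2 * t (J + 1) < _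
        linarith
      refine (mul_le_mul ih h1 measureReal_nonneg (Real.exp_pos _).le).trans_eq ?_
      rw [← Real.exp_add]
      congr 1
      push_cast
      ring
  refine ⟨a * (j₀ * (j₀ + 1) / 2), ?_⟩
  have hJtop : Tendsto (fun n : ℕ => ⌊Real.log n / Real.log r⌋₊) atTop atTop :=
    tendsto_nat_floor_atTop.comp
      ((Real.tendsto_log_atTop.comp tendsto_natCast_atTop_atTop).atTop_div_const hlogr)
  filter_upwards [hJtop.eventually_ge_atTop j₀, eventually_ge_atTop 1] with n hn hn1
  refine (measureReal_mono (persistenceEvent_subset_blockMoves htmono hsep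
    (fun j _ => htpos j) (fun j hj => ?_) ?_)).trans (hblock _ hn)
  · rw [ht]
    exact (hj₀ j hj).1
  · rw [ht]
    have hn0 : (0 : ℝ) < n := by exact_mod_cast hn1
    have hlog : 0 ≤ Real.log n := Real.log_nonneg (by exact_mod_cast hn1)
    refine Nat.ceil_le.2 ?_
    rw [← Real.log_le_log_iff (by positivity) hn0, Real.log_pow, ← le_div_iff₀ hlogr]
    exact Nat.floor_le (by positivity)

end UpperBound

/-! ### One big jump -/

section OneJump

variable {d : ℕ}

/-- Sequences of steps whose first `n` partial sums are bounded by `c`. -/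
def smallSums (d : ℕ) (c : ℝ) (n : ℕ) : Set (ℕ → EuclideanSpace ℝ (Fin d)) :=
  {y | ∀ k ≤ n, ‖∑ i ∈ Finset.range k, y i‖ ≤ c}

theorem measurableSet_smallSums (c : ℝ) (n : ℕ) : MeasurableSet (smallSums d c n) := by
  have : smallSums d c n = ⋂ k ∈ Set.Iic n,
      {y : ℕ → EuclideanSpace ℝ (Fin d) | ‖∑ i ∈ Finset.range k, y i‖ ≤ c} := by
    ext y
    simp only [smallSums, Set.mem_iInter, Set.mem_Iic]
    rfl
  rw [this]
  exact MeasurableSet.biInter (Set.to_countable _) fun k _ =>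
    measurableSet_le (measurable_sum_range k).norm measurable_const

/-- Sequences of steps with a jump close to `n b` at index `i`, and small fluctuations before and
after that jump. -/
def jumpPath (b : EuclideanSpace ℝ (Fin d)) (κ : ℝ) (n i : ℕ) :
    Set (ℕ → EuclideanSpace ℝ (Fin d)) :=
  {y | y ∈ smallSums d (κ * n) i ∧ (n : ℝ)⁻¹ • y i ∈ Metric.ball b κ ∧
    (fun j => y (i + 1 + j)) ∈ smallSums d (κ * n) n}

theorem measurable_shift (s : ℕ) :
    Measurable fun (y : ℕ → EuclideanSpace ℝ (Fin d)) j => y (s + j) :=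
  measurable_pi_iff.2 fun _ => measurable_pi_apply _

theorem measurableSet_scaled_ball (b : EuclideanSpace ℝ (Fin d)) (κ x : ℝ) (i : ℕ) :
    MeasurableSet {y : ℕ → EuclideanSpace ℝ (Fin d) | x⁻¹ • y i ∈ Metric.ball b κ} :=
  ((measurable_pi_apply i).const_smul x⁻¹) Metric.isOpen_ball.measurableSet

theorem measurableSet_jumpPath (b : EuclideanSpace ℝ (Fin d)) (κ : ℝ) (n i : ℕ) :
    MeasurableSet (jumpPath b κ n i) := by
  have h : jumpPath b κ n i = smallSums d (κ * n) i ∩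
      ({y | (n : ℝ)⁻¹ • y i ∈ Metric.ball b κ} ∩
        (fun y j => y (i + 1 + j)) ⁻¹' smallSums d (κ * n) n) := rfl
  rw [h]
  exact (measurableSet_smallSums _ _).inter ((measurableSet_scaled_ball b κ n i).inter
    (measurable_shift (i + 1) (measurableSet_smallSums _ _)))

theorem norm_sub_smul_lt_of_mem_ball {b v : EuclideanSpace ℝ (Fin d)} {κ x : ℝ} (hx : 0 < x)
    (h : x⁻¹ • v ∈ Metric.ball b κ) : ‖v - x • b‖ < κ * x := by
  rw [mem_ball_iff_norm] at h
  have h1 : v - x • b = x • (x⁻¹ • v - b) := by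
    rw [smul_sub, smul_smul, mul_inv_cancel₀ hx.ne', one_smul]
  rw [h1, norm_smul, Real.norm_of_nonneg hx.le, mul_comm]
  gcongr

/-- The jumps at different indices are disjoint possibilities: a second jump would be a large
fluctuation after the first one. -/
theorem disjoint_jumpPath {b : EuclideanSpace ℝ (Fin d)} {κ : ℝ} (hκ : 3 * κ < ‖b‖) {n i i' : ℕ}
    (hn : 0 < n) (hii' : i < i') (hi' : i' ≤ n) :
    Disjoint (jumpPath b κ n i) (jumpPath b κ n i') := by
  refine Set.disjoint_left.2 fun y hy hy' => ?_
  have hn' : (0 : ℝ) < n := by exact_mod_cast hn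
  obtain ⟨k, rfl⟩ : ∃ k, i' = i + 1 + k := ⟨i' - (i + 1), by omega⟩
  have h1 : ‖∑ j ∈ Finset.range k, y (i + 1 + j)‖ ≤ κ * n := hy.2.2 k (by omega)
  have h2 : ‖∑ j ∈ Finset.range (k + 1), y (i + 1 + j)‖ ≤ κ * n := hy.2.2 (k + 1) (by omega)
  have h3 := norm_sub_smul_lt_of_mem_ball hn' hy'.2.1
  have h4 : y (i + 1 + k) = ∑ j ∈ Finset.range (k + 1), y (i + 1 + j) -
      ∑ j ∈ Finset.range k, y (i + 1 + j) := by
    rw [Finset.sum_range_succ, add_sub_cancel_left]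
  have h5 : ‖y (i + 1 + k)‖ ≤ κ * n + κ * n := by
    rw [h4]; exact (norm_sub_le _ _).trans (add_le_add h2 h1)
  have h6 : ‖(n : ℝ) • b‖ ≤ ‖y (i + 1 + k)‖ + ‖y (i + 1 + k) - (n : ℝ) • b‖ := by
    have := norm_sub_le (y (i + 1 + k)) (y (i + 1 + k) - (n : ℝ) • b)
    rwa [sub_sub_cancel] at this
  rw [norm_smul, Real.norm_of_nonneg hn'.le] at h6
  have h7 := mul_lt_mul_of_pos_right hκ hn'
  linarith

theorem jumpPath_sum_after {b : EuclideanSpace ℝ (Fin d)} {κ : ℝ} {n i k : ℕ} (hn : 0 < n)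
    {y : ℕ → EuclideanSpace ℝ (Fin d)} (hy : y ∈ jumpPath b κ n i) (hik : i < k) (hk : k ≤ n) :
    ‖∑ j ∈ Finset.range k, y j - (n : ℝ) • b‖ ≤ 3 * κ * n := by
  have hn' : (0 : ℝ) < n := by exact_mod_cast hn
  obtain ⟨l, rfl⟩ : ∃ l, k = i + 1 + l := ⟨k - (i + 1), by omega⟩
  have h1 : ‖∑ j ∈ Finset.range l, y (i + 1 + j)‖ ≤ κ * n := hy.2.2 l (by omega)
  have h2 : ‖∑ j ∈ Finset.range i, y j‖ ≤ κ * n := hy.1 i le_rfl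
  have h3 := norm_sub_smul_lt_of_mem_ball hn' hy.2.1
  have h4 : ∑ j ∈ Finset.range (i + 1 + l), y j - (n : ℝ) • b =
      ∑ j ∈ Finset.range i, y j + (y i - (n : ℝ) • b) + ∑ j ∈ Finset.range l, y (i + 1 + j) := by
    rw [Finset.sum_range_add, Finset.sum_range_succ]
    abel
  rw [h4]
  refine (norm_add₃_le).trans ?_
  linarith

variable {Ω : Type*} [MeasurableSpace Ω] {P : Measure Ω} [IsProbabilityMeasure P]
  {X : ℕ → Ω → EuclideanSpace ℝ (Fin d)}

/-- The fluctuations before the jump, the jump, and the fluctuations after it are independent. -/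
theorem le_measure_jumpPath (hmeas : ∀ i, Measurable (X i)) (hindep : iIndepFun X P)
    (hident : ∀ i, IdentDistrib (X i) (X 0) P P) (b : EuclideanSpace ℝ (Fin d)) (κ : ℝ)
    {n i : ℕ} (hi : i ≤ n)
    (hdev : P.real {ω | ∃ k ≤ n, κ * n < ‖∑ j ∈ Finset.range k, X j ω‖} ≤ 1 / 4) :
    P.real {ω | (n : ℝ)⁻¹ • X 0 ω ∈ Metric.ball b κ} / 2 ≤
      P.real {ω | (fun k => X k ω) ∈ jumpPath b κ n i} := by
  set p := P.real {ω | (n : ℝ)⁻¹ • X 0 ω ∈ Metric.ball b κ}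
  have hp : 0 ≤ p := measureReal_nonneg
  have hmX : Measurable fun ω k => X k ω := measurable_pi_iff.2 hmeas
  have hsmall : 3 / 4 ≤ P.real {ω | (fun k => X k ω) ∈ smallSums d (κ * n) n} := by
    have h1 : {ω | (fun k => X k ω) ∈ smallSums d (κ * n) n} =
        {ω | ∃ k ≤ n, κ * n < ‖∑ j ∈ Finset.range k, X j ω‖}ᶜ := by
      ext ω
      show (∀ k ≤ n, _) ↔ ¬ ∃ k ≤ n, _
      push Not
      rfl
    have h2 : MeasurableSet {ω | (fun k => X k ω) ∈ smallSums d (κ * n) n} :=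
      hmX (measurableSet_smallSums _ _)
    rw [h1, MeasurableSet.compl_iff] at h2
    rw [h1, probReal_compl_eq_one_sub h2]
    linarith
  have hsmall' : 3 / 4 ≤ P.real {ω | (fun k => X (0 + k) ω) ∈ smallSums d (κ * n) i} := by
    refine hsmall.trans (measureReal_mono fun ω hω k hk => ?_)
    have := hω k (hk.trans hi)
    simpa only [zero_add] using this
  let H : Set (ℕ → EuclideanSpace ℝ (Fin d)) := {y | (n : ℝ)⁻¹ • y 0 ∈ Metric.ball b κ ∧
    (fun j => y (1 + j)) ∈ smallSums d (κ * n) n}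
  have hH : MeasurableSet H := (measurableSet_scaled_ball b κ n 0).inter
    (measurable_shift 1 (measurableSet_smallSums _ _))
  have hPH : P.real {ω | (fun k => X k ω) ∈ H} =
      p * P.real {ω | (fun k => X k ω) ∈ smallSums d (κ * n) n} := by
    refine measureReal_inter_shift_eq hmeas hindep hident (t := 1) ?_ (measurableSet_smallSums _ _)
    exact ((measurable_pastSigma X one_pos).const_smul (n : ℝ)⁻¹) Metric.isOpen_ball.measurableSet
  have hG : {ω | (fun k => X k ω) ∈ jumpPath b κ n i} =
      {ω | (fun k => X (0 + k) ω) ∈ smallSums d (κ * n) i} ∩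
        {ω | (fun k => X (i + k) ω) ∈ H} := by
    ext ω
    have h1 : (fun k => X (0 + k) ω) = fun k => X k ω := by simp only [zero_add]
    have h2 : (fun j => X (i + (1 + j)) ω) = fun j => X (i + 1 + j) ω := by
      simp only [add_assoc]
    show _ ↔ _ ∈ smallSums d (κ * n) i ∧ _ ∧ (fun j => X (i + (1 + j)) ω) ∈ _
    rw [h1, h2]
    rfl
  have hpast : MeasurableSet[pastSigma X i]
      {ω | (fun k => X (0 + k) ω) ∈ smallSums d (κ * n) i} := by
    refine measurableSet_pastSigma_shift X (m := i) (by omega) (measurableSet_smallSums _ _)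
      (fun y z hyz hy k hk => ?_) 0
    have hsum : ∑ j ∈ Finset.range k, z j = ∑ j ∈ Finset.range k, y j :=
      Finset.sum_congr rfl fun j hj => (hyz j ((Finset.mem_range.1 hj).trans_le hk)).symm
    rw [hsum]
    exact hy k hk
  rw [hG, measureReal_inter_shift_eq hmeas hindep hident hpast hH, hPH]
  calc p / 2 ≤ 3 / 4 * (p * (3 / 4)) := by linarith
    _ ≤ _ := by gcongr

/-- The probability of a suitable jump in a window of length of the order `n` is at least
`n * n ^ (-q₁)` up to a constant, if a single jump has probability at least `n ^ (-q₁)`. -/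
theorem le_measure_exists_jumpPath (hmeas : ∀ i, Measurable (X i)) (hindep : iIndepFun X P)
    (hident : ∀ i, IdentDistrib (X i) (X 0) P P) {b : EuclideanSpace ℝ (Fin d)} {κ q₁ q : ℝ}
    (hκ0 : 0 < κ) (hκ : 3 * κ < ‖b‖) (hq : q₁ - 1 < q)
    (hdev : ∀ᶠ n : ℕ in atTop,
      P.real {ω | ∃ k ≤ n, κ * n < ‖∑ j ∈ Finset.range k, X j ω‖} ≤ 1 / 4)
    (hball : ∀ᶠ x : ℝ in atTop, x ^ (-q₁) ≤ P.real {ω | x⁻¹ • X 0 ω ∈ Metric.ball b κ}) :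
    ∀ᶠ n : ℕ in atTop, ∀ m, ⌊κ * n⌋₊ ≤ m → m ≤ n → (n : ℝ) ^ (-q) ≤
      P.real {ω | (fun k => X k ω) ∈ ⋃ i ∈ Finset.Ico (m - ⌊κ * n⌋₊) m, jumpPath b κ n i} := by
  have hlarge : ∀ᶠ x : ℝ in atTop, 0 < x ∧ 2 ≤ κ * x ∧
      4 / κ * x ^ (-q) ≤ x ^ (1 - q₁) ∧
      x ^ (-q₁) ≤ P.real {ω | x⁻¹ • X 0 ω ∈ Metric.ball b κ} := by
    refine (eventually_gt_atTop 0).and (.and ?_ (.and ?_ hball))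
    · exact (tendsto_id.const_mul_atTop hκ0).eventually_ge_atTop 2
    · exact eventually_const_mul_rpow_le _ (by linarith)
  filter_upwards [hdev, tendsto_natCast_atTop_atTop.eventually hlarge] with
    n hn ⟨hn0, hn2, hnq, hnb⟩ m hm1 hm2
  have hn0' : 0 < n := by exact_mod_cast hn0
  have hmX : Measurable fun ω k => X k ω := measurable_pi_iff.2 hmeas
  have hset : {ω | (fun k => X k ω) ∈ ⋃ i ∈ Finset.Ico (m - ⌊κ * n⌋₊) m, jumpPath b κ n i} =
      ⋃ i ∈ Finset.Ico (m - ⌊κ * n⌋₊) m, {ω | (fun k => X k ω) ∈ jumpPath b κ n i} := by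
    ext ω
    constructor <;> intro h
    · obtain ⟨i, hi, h'⟩ := Set.mem_iUnion₂.1 (show _ ∈ ⋃ i ∈ _, _ from h)
      exact Set.mem_iUnion₂.2 ⟨i, hi, h'⟩
    · obtain ⟨i, hi, h'⟩ := Set.mem_iUnion₂.1 h
      exact Set.mem_iUnion₂.2 ⟨i, hi, h'⟩
  have hdisj : Set.PairwiseDisjoint (↑(Finset.Ico (m - ⌊κ * n⌋₊) m))
      fun i => {ω | (fun k => X k ω) ∈ jumpPath b κ n i} := by
    intro i hi i' hi' hne
    have h1 := (Finset.mem_Ico.1 (Finset.mem_coe.1 hi)).2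
    have h1' := (Finset.mem_Ico.1 (Finset.mem_coe.1 hi')).2
    rcases lt_or_gt_of_ne hne with h | h
    · exact (disjoint_jumpPath hκ hn0' h (by omega)).preimage _
    · exact ((disjoint_jumpPath hκ hn0' h (by omega)).preimage _).symm
  rw [hset, measureReal_biUnion_finset hdisj fun i _ => hmX (measurableSet_jumpPath b κ n i)]
  have hcard : ((Finset.Ico (m - ⌊κ * n⌋₊) m).card : ℝ) = (⌊κ * n⌋₊ : ℕ) := by
    rw [Nat.card_Ico]
    congr 1
    omega
  have hfloor : κ * n / 2 ≤ (⌊κ * n⌋₊ : ℕ) := by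
    have := Nat.lt_floor_add_one (κ * n)
    linarith
  calc (n : ℝ) ^ (-q) ≤ κ / 4 * (n : ℝ) ^ (1 - q₁) := by
        rw [div_mul_eq_mul_div, div_le_iff₀ hκ0] at hnq
        linarith
    _ = κ * n / 2 * ((n : ℝ) ^ (-q₁) / 2) := by
        rw [sub_eq_add_neg, Real.rpow_add hn0, Real.rpow_one]; ring
    _ ≤ (⌊κ * n⌋₊ : ℕ) * (P.real {ω | (n : ℝ)⁻¹ • X 0 ω ∈ Metric.ball b κ} / 2) := by gcongr
    _ = ∑ _i ∈ Finset.Ico (m - ⌊κ * n⌋₊) m,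
          P.real {ω | (n : ℝ)⁻¹ • X 0 ω ∈ Metric.ball b κ} / 2 := by
        rw [Finset.sum_const, nsmul_eq_mul, hcard]
    _ ≤ _ := Finset.sum_le_sum fun i hi => le_measure_jumpPath hmeas hindep hident b κ
        (by have := (Finset.mem_Ico.1 hi).2; omega) hn

end OneJump

/-! ### The lower bound -/

section Deterministic

variable {E : Type*} [NormedAddCommGroup E] [NormedSpace ℝ E]

/-- Before the jump the average moves radially towards the origin. -/
theorem norm_average_before_jump {a D w : E} {t t' k r ρ κ : ℝ} (ht : 0 < t) (htk : t ≤ k)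
    (hr : 0 ≤ r)
    (ht' : t' ≤ r * t) (hκ : 0 ≤ κ) (ha : ‖t⁻¹ • a - w‖ ≤ ρ) (hD : ‖D‖ ≤ κ * t') :
    ‖k⁻¹ • (a + D) - (t / k) • w‖ ≤ ρ + κ * r := by
  have hk : 0 < k := ht.trans_le htk
  have h1 : k⁻¹ • (a + D) - (t / k) • w = (t / k) • (t⁻¹ • a - w) + k⁻¹ • D := by
    have : t / k * t⁻¹ = k⁻¹ := by field_simp
    rw [smul_sub, smul_smul, this, smul_add]
    abel
  rw [h1]
  refine (norm_add_le _ _).trans ?_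
  rw [norm_smul, norm_smul, Real.norm_of_nonneg (by positivity),
    Real.norm_of_nonneg (by positivity)]
  refine add_le_add ?_ ?_
  · calc t / k * ‖t⁻¹ • a - w‖ ≤ 1 * ‖t⁻¹ • a - w‖ := by
          gcongr; exact (div_le_one hk).2 htk
      _ ≤ ρ := by rwa [one_mul]
  · rw [inv_mul_le_iff₀ hk]
    calc ‖D‖ ≤ κ * t' := hD
      _ ≤ κ * (r * t) := by gcongr
      _ = r * κ * t := by ring
      _ ≤ k * (κ * r) := by
        nlinarith [mul_nonneg hκ hr]

/-- After the jump the sum is close to `t' w`; the error does not exceed the previous one. -/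
theorem norm_sum_after_jump {a D w : E} {t t' u ρ κ : ℝ} (ht : 0 < t) (ht' : 0 < t')
    (hρ : (u + κ) * ρ + κ * (‖w‖ + 3) ≤ ρ) (hu : |t / t' - u| ≤ κ)
    (ha : ‖t⁻¹ • a - w‖ ≤ ρ) (hD : ‖D - t' • (1 - u) • w‖ ≤ 3 * κ * t') :
    ‖t'⁻¹ • (a + D) - w‖ ≤ ρ := by
  have h1 : t'⁻¹ • (a + D) - w = (t / t') • (t⁻¹ • a - w) + (t / t' - u) • w +
      t'⁻¹ • (D - t' • (1 - u) • w) := by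
    have h2 : t / t' * t⁻¹ = t'⁻¹ := by field_simp
    have h3 : t'⁻¹ * t' = 1 := inv_mul_cancel₀ ht'.ne'
    rw [smul_sub (t / t'), smul_smul (t / t'), h2, smul_sub t'⁻¹, smul_smul t'⁻¹ t', h3, one_smul,
      smul_add, sub_smul, sub_smul, one_smul]
    abel
  rw [h1]
  refine norm_add₃_le.trans (le_trans ?_ hρ)
  rw [norm_smul, norm_smul, norm_smul, Real.norm_of_nonneg (by positivity), Real.norm_eq_abs,
    Real.norm_of_nonneg (by positivity)]
  have h4 : t / t' * ‖t⁻¹ • a - w‖ ≤ (u + κ) * ρ := by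
    have : t / t' ≤ u + κ := by linarith [(abs_le.1 hu).2]
    have h0 : 0 ≤ t / t' := by positivity
    gcongr
    linarith
  have h5 : |t / t' - u| * ‖w‖ ≤ κ * ‖w‖ := by gcongr
  have h6 : t'⁻¹ * ‖D - t' • (1 - u) • w‖ ≤ 3 * κ := by
    rw [inv_mul_le_iff₀ ht']
    linarith
  linarith

/-- Shortly before time `t'` the average is close to `w` if the sum is close to `t' w`. -/
theorem norm_average_after_jump {s w : E} {t' k ρ κ : ℝ} (hk : 0 < k) (hkt : k ≤ t')
    (hκ1 : κ ≤ 1 / 2) (hκk : (1 - κ) * t' ≤ k) (hs : ‖t'⁻¹ • s - w‖ ≤ ρ) :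
    ‖k⁻¹ • s - w‖ ≤ 2 * ρ + 2 * κ * ‖w‖ := by
  have ht' : 0 < t' := hk.trans_le hkt
  have h1 : k⁻¹ • s - w = (t' / k) • (t'⁻¹ • s - w) + (t' / k - 1) • w := by
    have h2 : t' / k * t'⁻¹ = k⁻¹ := by field_simp
    rw [smul_sub, smul_smul, h2, sub_smul, one_smul]
    abel
  have h2 : t' / k ≤ 2 := by
    rw [div_le_iff₀ hk]
    nlinarith
  have h3 : t' / k - 1 ≤ 2 * κ := by
    rw [div_sub_one hk.ne', div_le_iff₀ hk]
    nlinarith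
  have h4 : 0 ≤ t' / k - 1 := by rw [sub_nonneg, one_le_div hk]; exact hkt
  rw [h1]
  refine (norm_add_le _ _).trans ?_
  rw [norm_smul, norm_smul, Real.norm_of_nonneg (by positivity), Real.norm_of_nonneg h4]
  gcongr

end Deterministic

section LowerBound

variable {d : ℕ} {A : Set (EuclideanSpace ℝ (Fin d))} {w : EuclideanSpace ℝ (Fin d)}

/-- Step sequences whose averages stay in `A` up to time `t`, the last of them being within
distance `ρ` of `w`. -/
def goodPath (A : Set (EuclideanSpace ℝ (Fin d))) (w : EuclideanSpace ℝ (Fin d)) (ρ : ℝ) (t : ℕ) :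
    Set (ℕ → EuclideanSpace ℝ (Fin d)) :=
  {y | (∀ k : ℕ, 1 ≤ k → k ≤ t → (k : ℝ)⁻¹ • ∑ i ∈ Finset.range k, y i ∈ A) ∧
    ‖(t : ℝ)⁻¹ • ∑ i ∈ Finset.range t, y i - w‖ ≤ ρ}

theorem goodPath_congr {ρ : ℝ} {t : ℕ} {y z : ℕ → EuclideanSpace ℝ (Fin d)}
    (hyz : ∀ i < t, y i = z i) (hy : y ∈ goodPath A w ρ t) : z ∈ goodPath A w ρ t := by
  have hsum : ∀ k ≤ t, ∑ i ∈ Finset.range k, z i = ∑ i ∈ Finset.range k, y i := fun k hk =>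
    Finset.sum_congr rfl fun i hi => (hyz i ((Finset.mem_range.1 hi).trans_le hk)).symm
  refine ⟨fun k h1 h2 => ?_, ?_⟩
  · rw [hsum k h2]; exact hy.1 k h1 h2
  · rw [hsum t le_rfl]; exact hy.2

theorem measurableSet_goodPath (hA : IsClosed A) (w : EuclideanSpace ℝ (Fin d)) (ρ : ℝ) (t : ℕ) :
    MeasurableSet (goodPath A w ρ t) := by
  have h : goodPath A w ρ t = (⋂ k ∈ Set.Icc 1 t,
      (fun y : ℕ → EuclideanSpace ℝ (Fin d) => (k : ℝ)⁻¹ • ∑ i ∈ Finset.range k, y i) ⁻¹' A) ∩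
      {y | ‖(t : ℝ)⁻¹ • ∑ i ∈ Finset.range t, y i - w‖ ≤ ρ} := by
    ext y
    simp only [goodPath, Set.mem_inter_iff, Set.mem_iInter, Set.mem_Icc, and_imp]
    rfl
  rw [h]
  have hm : ∀ k : ℕ, Measurable fun y : ℕ → EuclideanSpace ℝ (Fin d) =>
      (k : ℝ)⁻¹ • ∑ i ∈ Finset.range k, y i := fun k =>
    (measurable_sum_range k).const_smul (k : ℝ)⁻¹
  exact (MeasurableSet.biInter (Set.to_countable _) fun k _ => hm k hA.measurableSet).inter
    (measurableSet_le ((hm t).sub_const w).norm measurable_const)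

/-- One jump in the window before time `t'` leads from a good position at time `t` to a good
position at time `t'`. -/
theorem goodPath_step {r u η ρ κ : ℝ} {t t' i : ℕ} {x : ℕ → EuclideanSpace ℝ (Fin d)}
    (hA : ∀ (s : ℝ) (v : EuclideanSpace ℝ (Fin d)), r⁻¹ ≤ s → s ≤ 1 → ‖v - s • w‖ ≤ η → v ∈ A)
    (hr : 1 ≤ r) (hκ0 : 0 ≤ κ) (hκ1 : κ ≤ 1 / 2) (h1 : ρ + κ * r ≤ η)
    (h2 : 2 * ρ + 2 * κ * ‖w‖ ≤ η) (h3 : (u + κ) * ρ + κ * (‖w‖ + 3) ≤ ρ)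
    (ht : 0 < t) (htt' : t ≤ t') (htr : (t' : ℝ) ≤ r * t) (hu : |(t : ℝ) / t' - u| ≤ κ)
    (hi1 : t' - t - ⌊κ * t'⌋₊ ≤ i) (hi2 : i < t' - t)
    (hx : x ∈ goodPath A w ρ t) (hy : (fun j => x (t + j)) ∈ jumpPath ((1 - u) • w) κ t' i) :
    x ∈ goodPath A w ρ t' := by
  have ht0 : (0 : ℝ) < t := by exact_mod_cast ht
  have ht'0 : 0 < t' := ht.trans_le htt'
  have ht'0' : (0 : ℝ) < t' := by exact_mod_cast ht'0
  have hafter : ∀ k, i < k → k ≤ t' - t →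
      ‖(t' : ℝ)⁻¹ • ∑ j ∈ Finset.range (t + k), x j - w‖ ≤ ρ := by
    intro k hik hk
    rw [Finset.sum_range_add]
    exact norm_sum_after_jump ht0 ht'0' h3 hu hx.2
      (jumpPath_sum_after ht'0 hy hik (hk.trans (Nat.sub_le _ _)))
  refine ⟨fun k hk1 hk2 => ?_, ?_⟩
  · rcases le_or_gt k t with hkt | hkt
    · exact hx.1 k hk1 hkt
    · obtain ⟨l, rfl⟩ : ∃ l, k = t + l := ⟨k - t, by omega⟩
      have hk0 : (0 : ℝ) < (t + l : ℕ) := by exact_mod_cast (by omega : 0 < t + l)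
      have htl : (t : ℝ) ≤ (t + l : ℕ) := by exact_mod_cast Nat.le_add_right t l
      have hlt' : ((t + l : ℕ) : ℝ) ≤ t' := by exact_mod_cast hk2
      rcases le_or_gt l i with hli | hli
      · refine hA (t / (t + l : ℕ)) _ ?_ ((div_le_one hk0).2 htl) ?_
        · rw [inv_eq_one_div, div_le_div_iff₀ (by linarith) hk0]
          linarith
        · rw [Finset.sum_range_add]
          exact (norm_average_before_jump ht0 htl (by linarith) htr hκ0 hx.2 (hy.1 l hli)).trans h1
      · refine hA 1 _ (inv_le_one_of_one_le₀ hr) le_rfl ?_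
        rw [one_smul]
        refine (norm_average_after_jump hk0 hlt' hκ1 ?_ (hafter l hli (by omega))).trans h2
        have h5 : t' ≤ t + l + ⌊κ * t'⌋₊ := by omega
        have h6 : (t' : ℝ) ≤ (t + l : ℕ) + (⌊κ * t'⌋₊ : ℕ) := by exact_mod_cast h5
        have h7 : ((⌊κ * t'⌋₊ : ℕ) : ℝ) ≤ κ * t' := Nat.floor_le (by positivity)
        linarith
  · have := hafter (t' - t) hi2 le_rfl
    rwa [Nat.add_sub_cancel' htt'] at this

variable {Ω : Type*} [MeasurableSpace Ω] {P : Measure Ω} [IsProbabilityMeasure P]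
  {X : ℕ → Ω → EuclideanSpace ℝ (Fin d)}

/-- Markov property at time `t`: a good position at time `t` followed by a continuation in `J` leads
to a good position at time `t'`. -/
theorem le_measure_goodPath_step (hmeas : ∀ i, Measurable (X i)) (hindep : iIndepFun X P)
    (hident : ∀ i, IdentDistrib (X i) (X 0) P P) (hclosed : IsClosed A) {ρ c : ℝ} {t t' : ℕ}
    {J : Set (ℕ → EuclideanSpace ℝ (Fin d))} (hJ : MeasurableSet J)
    (hstep : ∀ x, x ∈ goodPath A w ρ t → (fun j => x (t + j)) ∈ J → x ∈ goodPath A w ρ t')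
    (hc : c ≤ P.real {ω | (fun k => X k ω) ∈ J}) :
    P.real {ω | (fun k => X k ω) ∈ goodPath A w ρ t} * c ≤
      P.real {ω | (fun k => X k ω) ∈ goodPath A w ρ t'} := by
  have hpast : MeasurableSet[pastSigma X t] {ω | (fun k => X k ω) ∈ goodPath A w ρ t} := by
    have := measurableSet_pastSigma_shift X (s := 0) (m := t) (t := t) (by omega)
      (measurableSet_goodPath hclosed w ρ t) (fun y z hyz hy => goodPath_congr hyz hy) 0
    simpa only [zero_add] using this
  calc P.real {ω | (fun k => X k ω) ∈ goodPath A w ρ t} * c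
      ≤ P.real {ω | (fun k => X k ω) ∈ goodPath A w ρ t} * P.real {ω | (fun k => X k ω) ∈ J} := by
        gcongr
    _ = P.real ({ω | (fun k => X k ω) ∈ goodPath A w ρ t} ∩ {ω | (fun k => X (t + k) ω) ∈ J}) :=
        (measureReal_inter_shift_eq hmeas hindep hident hpast hJ).symm
    _ ≤ _ := measureReal_mono fun ω hω => hstep _ hω.1 hω.2

/-- A good position can be reached at every large time: take small steps to stay near a point of
`A`, followed by a single jump. -/
theorem eventually_measure_goodPath_pos (hmeas : ∀ i, Measurable (X i)) (hindep : iIndepFun X P)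
    (hident : ∀ i, IdentDistrib (X i) (X 0) P P) (hd : 0 < d)
    (hjump : 0 < P {ω | X 0 ω ∈ interior A}) {ρ : ℝ} (hρ : 0 < ρ)
    (hw : Metric.closedBall w ρ ⊆ A)
    (hball : ∀ b : EuclideanSpace ℝ (Fin d), b ≠ 0 → ∀ s : ℝ, 0 < s →
      ∀ᶠ x : ℝ in atTop, 0 < P.real {ω | x⁻¹ • X 0 ω ∈ Metric.ball b s}) :
    ∀ᶠ t : ℕ in atTop, 0 < P.real {ω | (fun k => X k ω) ∈ goodPath A w ρ t} := by
  have hjump' : P.map (X 0) (interior A) ≠ 0 := by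
    rw [Measure.map_apply (hmeas 0) isOpen_interior.measurableSet]
    exact hjump.ne'
  obtain ⟨x₀, hx₀, hx₀pos⟩ := exists_mem_forall_mem_nhdsWithin_pos_measure hjump'
  obtain ⟨ε₀, hε₀, hε₀A⟩ := Metric.nhds_basis_closedBall.mem_iff.1
    (mem_interior_iff_mem_nhds.1 hx₀)
  obtain ⟨ε, hε, hεε₀, hερ⟩ : ∃ ε, 0 < ε ∧ ε ≤ ε₀ ∧ ε ≤ ρ / 4 :=
    ⟨min ε₀ (ρ / 4), by positivity, min_le_left _ _, min_le_right _ _⟩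
  have hmass : 0 < P {ω | X 0 ω ∈ Metric.closedBall x₀ ε} := by
    have := hx₀pos _ (mem_nhdsWithin_of_mem_nhds (Metric.closedBall_mem_nhds x₀ hε))
    rwa [Measure.map_apply (hmeas 0) Metric.isClosed_closedBall.measurableSet] at this
  -- A nonzero jump direction close to `w - x₀`.
  obtain ⟨b, hb0, hb⟩ : ∃ b : EuclideanSpace ℝ (Fin d), b ≠ 0 ∧ ‖b - (w - x₀)‖ ≤ ρ / 4 := by
    by_cases h : w - x₀ = 0
    · have : Nonempty (Fin d) := ⟨⟨0, hd⟩⟩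
      obtain ⟨v, hv⟩ := exists_norm_eq (EuclideanSpace ℝ (Fin d)) (show 0 ≤ ρ / 4 by positivity)
      refine ⟨v, fun hv0 => ?_, by rw [h, sub_zero, hv]⟩
      rw [hv0, norm_zero] at hv
      linarith
    · exact ⟨_, h, by rw [sub_self, norm_zero]; positivity⟩
  filter_upwards [tendsto_natCast_atTop_atTop.eventually (hball b hb0 (ρ / 4) (by positivity)),
    tendsto_natCast_atTop_atTop.eventually (eventually_ge_atTop (4 * ‖x₀‖ / ρ)),
    eventually_ge_atTop 1] with t htball htx ht1
  obtain ⟨m, rfl⟩ : ∃ m, t = m + 1 := ⟨t - 1, by omega⟩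
  have ht0 : (0 : ℝ) < (m + 1 : ℕ) := by positivity
  set τ : ℝ := ((m + 1 : ℕ) : ℝ) with hτ
  let B : ℕ → Set (EuclideanSpace ℝ (Fin d)) := fun i =>
    if i < m then Metric.closedBall x₀ ε else (fun v => τ⁻¹ • v) ⁻¹' Metric.ball b (ρ / 4)
  have hBm : ∀ i, MeasurableSet (B i) := by
    intro i
    simp only [B]
    split_ifs
    · exact Metric.isClosed_closedBall.measurableSet
    · exact (measurable_const_smul τ⁻¹) Metric.isOpen_ball.measurableSet
  have hBpos : ∀ i, 0 < P (X i ⁻¹' B i) := by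
    intro i
    rw [(hident i).measure_mem_eq (hBm i)]
    simp only [B]
    split_ifs
    · exact hmass
    · exact (ENNReal.toReal_pos_iff.1 htball).1
  have hinter := hindep.measure_inter_preimage_eq_mul (Finset.range (m + 1))
    (sets := B) fun i _ => hBm i
  refine lt_of_lt_of_le ?_ (measureReal_mono
    (s₁ := ⋂ i ∈ Finset.range (m + 1), X i ⁻¹' B i) fun ω hω => ?_)
  · refine ENNReal.toReal_pos ?_ (measure_ne_top _ _)
    rw [hinter]
    exact Finset.prod_ne_zero_iff.2 fun i _ => (hBpos i).ne'
  · have hω' : ∀ i < m + 1, X i ω ∈ B i := fun i hi =>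
      Set.mem_iInter₂.1 hω i (Finset.mem_range.2 hi)
    have hsmall : ∀ i < m, ‖X i ω - x₀‖ ≤ ε := by
      intro i hi
      have := hω' i (by omega)
      simp only [B, if_pos hi] at this
      rwa [mem_closedBall_iff_norm] at this
    have hbig : ‖τ⁻¹ • X m ω - b‖ < ρ / 4 := by
      have := hω' m (by omega)
      simp only [B, lt_irrefl, if_false, Set.mem_preimage] at this
      rwa [mem_ball_iff_norm] at this
    have hsum : ∀ k ≤ m, ‖∑ i ∈ Finset.range k, X i ω - (k : ℝ) • x₀‖ ≤ k * ε := by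
      intro k hk
      have h1 : ∑ i ∈ Finset.range k, X i ω - (k : ℝ) • x₀ =
          ∑ i ∈ Finset.range k, (X i ω - x₀) := by
        rw [Finset.sum_sub_distrib, Finset.sum_const, Finset.card_range, Nat.cast_smul_eq_nsmul]
      rw [h1]
      refine (norm_sum_le_of_le _ fun i hi =>
        hsmall i ((Finset.mem_range.1 hi).trans_le hk)).trans_eq ?_
      simp
    have hend : ‖τ⁻¹ • ∑ i ∈ Finset.range (m + 1), X i ω - w‖ ≤ ρ := by
      have h1 : τ⁻¹ • ∑ i ∈ Finset.range (m + 1), X i ω - w =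
          τ⁻¹ • (∑ i ∈ Finset.range m, X i ω - (m : ℝ) • x₀) + (τ⁻¹ • X m ω - b) +
            (b - (w - x₀)) + -(τ⁻¹ • x₀) := by
        have h2 : τ⁻¹ • (m : ℝ) • x₀ = x₀ - τ⁻¹ • x₀ := by
          rw [smul_smul]
          have : τ⁻¹ * m = 1 - τ⁻¹ := by
            rw [eq_sub_iff_add_eq, ← mul_add_one, hτ, Nat.cast_add_one]
            exact inv_mul_cancel₀ (by positivity)
          rw [this, sub_smul, one_smul]
        rw [Finset.sum_range_succ, smul_add, smul_sub, h2]
        abel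
      have h3 : ‖τ⁻¹ • (∑ i ∈ Finset.range m, X i ω - (m : ℝ) • x₀)‖ ≤ ρ / 4 := by
        rw [norm_smul, norm_inv, Real.norm_of_nonneg ht0.le, inv_mul_le_iff₀ ht0]
        have hmτ : (m : ℝ) ≤ τ := by rw [hτ]; exact_mod_cast Nat.le_succ m
        exact (hsum m le_rfl).trans (by gcongr)
      have h4 : ‖-(τ⁻¹ • x₀)‖ ≤ ρ / 4 := by
        rw [norm_neg, norm_smul, norm_inv, Real.norm_of_nonneg ht0.le, inv_mul_le_iff₀ ht0]
        rw [div_le_iff₀ hρ] at htx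
        linarith
      rw [h1]
      refine (norm_add_le _ _).trans ?_
      have := norm_add₃_le (a := τ⁻¹ • (∑ i ∈ Finset.range m, X i ω - (m : ℝ) • x₀))
        (b := τ⁻¹ • X m ω - b) (c := b - (w - x₀))
      linarith
    refine ⟨fun k hk1 hk2 => ?_, hend⟩
    rcases Nat.lt_or_ge m k with hmk | hmk
    · obtain rfl : k = m + 1 := by omega
      exact hw (mem_closedBall_iff_norm.2 hend)
    · refine hε₀A (Metric.closedBall_subset_closedBall hεε₀ (mem_closedBall_iff_norm.2 ?_))
      have hk0 : (0 : ℝ) < k := by exact_mod_cast hk1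
      have h1 : (k : ℝ)⁻¹ • ∑ i ∈ Finset.range k, X i ω - x₀ =
          (k : ℝ)⁻¹ • (∑ i ∈ Finset.range k, X i ω - (k : ℝ) • x₀) := by
        rw [smul_sub, smul_smul, inv_mul_cancel₀ hk0.ne', one_smul]
      show ‖(k : ℝ)⁻¹ • ∑ i ∈ Finset.range k, X i ω - x₀‖ ≤ ε
      rw [h1, norm_smul, norm_inv, Real.norm_of_nonneg hk0.le, inv_mul_le_iff₀ hk0]
      exact hsum k hmk

end LowerBound

section LowerBound

variable {d : ℕ} {A : Set (EuclideanSpace ℝ (Fin d))}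

theorem eventually_add_mul_lt {a c : ℝ} (b : ℝ) (h : a < c) :
    ∀ᶠ κ : ℝ in 𝓝[>] 0, a + κ * b < c := by
  have h1 : Tendsto (fun κ : ℝ => a + κ * b) (𝓝 0) (𝓝 a) :=
    (by fun_prop : Continuous fun κ : ℝ => a + κ * b).tendsto' _ _ (by simp)
  exact (h1.eventually_lt_const h).filter_mono nhdsWithin_le_nhds

/-- A whole neighbourhood of the radial segment from `r⁻¹ • w` to `w` is contained in `A` if its
ends are interior points. -/
theorem exists_tube_subset (hconv : Convex ℝ A) {w : EuclideanSpace ℝ (Fin d)} {r : ℝ}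
    (hr : 1 ≤ r) (hw : w ∈ interior A) (hrw : r⁻¹ • w ∈ interior A) :
    ∃ η > 0, ∀ (s : ℝ) (v : EuclideanSpace ℝ (Fin d)), r⁻¹ ≤ s → s ≤ 1 → ‖v - s • w‖ ≤ η →
      v ∈ A := by
  have hcont : Continuous fun s : ℝ => s • w := by fun_prop
  have hK : IsCompact ((fun s : ℝ => s • w) '' Set.Icc r⁻¹ 1) := isCompact_Icc.image hcont
  have hsub : (fun s : ℝ => s • w) '' Set.Icc r⁻¹ 1 ⊆ interior A := by
    rintro _ ⟨s, hs, rfl⟩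
    rw [← segment_eq_Icc (inv_le_one_of_one_le₀ hr)] at hs
    obtain ⟨a, b, ha, hb, hab, rfl⟩ := hs
    have := hconv.interior hrw hw ha hb hab
    rwa [smul_smul, ← add_smul, show a * r⁻¹ + b = a • r⁻¹ + b • (1 : ℝ) by simp] at this
  obtain ⟨η, hη, hηA⟩ := hK.exists_cthickening_subset_open isOpen_interior hsub
  refine ⟨η, hη, fun s v hs1 hs2 hv => interior_subset (hηA ?_)⟩
  exact Metric.mem_cthickening_of_dist_le v (s • w) η _ ⟨s, ⟨hs1, hs2⟩, rfl⟩ (by rwa [dist_eq_norm])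

theorem tendsto_natFloor_pow_ratio {r : ℝ} (hr : 1 < r) :
    Tendsto (fun j : ℕ => ((⌊r ^ j⌋₊ : ℕ) : ℝ) / (⌊r ^ (j + 1)⌋₊ : ℕ)) atTop (𝓝 r⁻¹) := by
  have h1 : Tendsto (fun j : ℕ => ((⌊r ^ j⌋₊ : ℕ) : ℝ) / r ^ j) atTop (𝓝 1) :=
    tendsto_nat_floor_div_atTop.comp (tendsto_pow_atTop_atTop_of_one_lt hr)
  have h2 := (h1.div ((tendsto_add_atTop_iff_nat 1).2 h1) one_ne_zero).mul_const r⁻¹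
  rw [div_one, one_mul] at h2
  refine h2.congr fun j => ?_
  have hr0 : r ≠ 0 := by linarith
  show (⌊r ^ j⌋₊ : ℝ) / r ^ j / ((⌊r ^ (j + 1)⌋₊ : ℝ) / r ^ (j + 1)) * r⁻¹ = _
  rw [pow_succ r j]
  field_simp

variable {Ω : Type*} [MeasurableSpace Ω] {P : Measure Ω} [IsProbabilityMeasure P]
  {X : ℕ → Ω → EuclideanSpace ℝ (Fin d)}

/-- The lower bound: a single jump per block between the times `r ^ j`, where `r < r*`, keeps the
averages in `A`, and such a jump has probability at least `r ^ (-q j)`. -/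
theorem persistence_lower_bound (hmeas : ∀ i, Measurable (X i)) (hindep : iIndepFun X P)
    (hident : ∀ i, IdentDistrib (X i) (X 0) P P) (hd : 0 < d) (hA : IsCompact A)
    (hconv : Convex ℝ A) (h0 : 0 ∉ A) (hint : (interior A).Nonempty)
    (hjump : 0 < P {ω | X 0 ω ∈ interior A}) {q₁ q r : ℝ} (hq : 0 ≤ q) (hq₁ : q₁ - 1 < q)
    (hr1 : 1 < r) (hr : r < rStar A)
    (hdev : ∀ δ : ℝ, 0 < δ → ∀ᶠ m : ℕ in atTop,
      P.real {ω | ∃ k ≤ m, δ * m < ‖∑ i ∈ Finset.range k, X i ω‖} ≤ 1 / 4)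
    (hball : ∀ b : EuclideanSpace ℝ (Fin d), b ≠ 0 → ∀ s : ℝ, 0 < s →
      ∀ᶠ x : ℝ in atTop, x ^ (-q₁) ≤ P.real {ω | x⁻¹ • X 0 ω ∈ Metric.ball b s}) :
    ∃ C : ℝ, ∀ᶠ n : ℕ in atTop,
      Real.exp (C - q * Real.log r * ((⌈Real.log n / Real.log r⌉₊ : ℝ) *
        (⌈Real.log n / Real.log r⌉₊ + 1) / 2)) ≤ P.real (persistenceEvent X A n) := by
  have hlogr : 0 < Real.log r := Real.log_pos hr1
  have hr0 : 0 < r := by linarith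
  -- The geometry is arranged with a ratio `r'` slightly larger than that of the block ends.
  obtain ⟨r', hrr', hr'⟩ := exists_between hr
  have hr'1 : 1 < r' := hr1.trans hrr'
  obtain ⟨w, hw, hrw⟩ := exists_interior_ray hA hconv h0 hint hr'1 hr'
  obtain ⟨η, hη, hηA⟩ := exists_tube_subset hconv hr'1.le hw hrw
  have hw0 : w ≠ 0 := fun h => h0 (h ▸ interior_subset hw)
  obtain ⟨u, hu⟩ : ∃ u, u = r⁻¹ := ⟨_, rfl⟩
  have hu1 : u < 1 := by rw [hu]; exact inv_lt_one_of_one_lt₀ hr1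
  have hb0 : (1 - u) • w ≠ 0 := smul_ne_zero (by linarith) hw0
  obtain ⟨ρ, hρdef⟩ : ∃ ρ, ρ = η / 4 := ⟨_, rfl⟩
  have hρ : 0 < ρ := by rw [hρdef]; positivity
  obtain ⟨κ, ⟨c1, c2, c3, c4, c5, c6⟩, hκ0⟩ :=
    ((eventually_add_mul_lt 1 (show (0 : ℝ) < 1 / 2 by norm_num)).and <|
    (eventually_add_mul_lt r' (show ρ < η by linarith)).and <|
    (eventually_add_mul_lt (2 * ‖w‖) (show 2 * ρ < η by linarith)).and <|
    (eventually_add_mul_lt (ρ + (‖w‖ + 3)) (show u * ρ < ρ by nlinarith)).and <|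
    (eventually_add_mul_lt 3 (norm_pos_iff.2 hb0)).and <|
    (eventually_add_mul_lt 2 hu1)).and (self_mem_nhdsWithin (s := Set.Ioi (0 : ℝ))) |>.exists
  replace hκ0 : 0 < κ := hκ0
  obtain ⟨t, ht⟩ : ∃ t : ℕ → ℕ, t = fun j => ⌊r ^ j⌋₊ := ⟨_, rfl⟩
  have hpowtop := tendsto_pow_atTop_atTop_of_one_lt hr1
  have htop : Tendsto t atTop atTop := ht ▸ tendsto_nat_floor_atTop.comp hpowtop
  have htmono : Monotone t := fun i j hij => by
    rw [ht]; exact Nat.floor_mono (pow_le_pow_right₀ hr1.le hij)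
  have htle : ∀ j, (t j : ℝ) ≤ r ^ j := fun j => by rw [ht]; exact Nat.floor_le (by positivity)
  have hratio : Tendsto (fun j => (t j : ℝ) / t (j + 1)) atTop (𝓝 u) := by
    rw [ht, hu]; exact tendsto_natFloor_pow_ratio hr1
  have hjumps := (htop.comp (tendsto_add_atTop_nat 1)).eventually
    (le_measure_exists_jumpPath hmeas hindep hident (b := (1 - u) • w) hκ0 (by linarith) hq₁
      (hdev κ hκ0) (hball _ hb0 κ hκ0))
  have hstart := htop.eventually (eventually_measure_goodPath_pos (A := A) (w := w) hmeas hindep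
    hident hd hjump hρ (fun v hv => hηA 1 v (inv_le_one_of_one_le₀ hr'1.le) le_rfl (by
      rw [one_smul]
      exact (mem_closedBall_iff_norm.1 hv).trans (by linarith)))
    (fun b hb s hs => by
      filter_upwards [hball b hb s hs, eventually_gt_atTop 0] with x hx hx0
      exact (Real.rpow_pos_of_pos hx0 _).trans_le hx))
  have hr'u : r'⁻¹ < u := by rw [hu]; exact (inv_lt_inv₀ (by linarith) hr0).2 hrr'
  obtain ⟨j₀, hj₀⟩ := eventually_atTop.1 ((hjumps.and hstart).and
    ((hratio.eventually_const_lt hr'u).and ((hratio.eventually (Metric.closedBall_mem_nhds u hκ0)).and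
      (htop.eventually_ge_atTop 1))))
  set a := q * Real.log r with ha
  set p₀ := P.real {ω | (fun k => X k ω) ∈ goodPath A w ρ (t j₀)}
  have hp₀ : 0 < p₀ := (hj₀ j₀ le_rfl).1.2
  have hchain : ∀ J, j₀ ≤ J → p₀ * Real.exp (a * (j₀ * (j₀ + 1) / 2) - a * (J * (J + 1) / 2)) ≤
      P.real {ω | (fun k => X k ω) ∈ goodPath A w ρ (t J)} := by
    intro J hJ
    induction J, hJ using Nat.le_induction with
    | base => rw [sub_self, Real.exp_zero, mul_one]
    | succ J hJ ih =>
      obtain ⟨⟨hjmp, -⟩, hrat1, hrat2, ht1⟩ := hj₀ J hJ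
      have htJ : t J ≤ t (J + 1) := htmono (Nat.le_succ J)
      have ht0 : (0 : ℝ) < t J := by exact_mod_cast ht1
      have ht0' : (0 : ℝ) < t (J + 1) := ht0.trans_le (by exact_mod_cast htJ)
      have hrat2' : |(t J : ℝ) / t (J + 1) - u| ≤ κ := by
        have : (t J : ℝ) / t (J + 1) ∈ Metric.closedBall u κ := hrat2
        rwa [mem_closedBall_iff_norm, Real.norm_eq_abs] at this
      have hwin : ⌊κ * t (J + 1)⌋₊ ≤ t (J + 1) - t J := by
        refine Nat.le_sub_of_add_le ?_
        have h1 : ((⌊κ * t (J + 1)⌋₊ : ℕ) : ℝ) ≤ κ * t (J + 1) := Nat.floor_le (by positivity)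
        have h2 : (t J : ℝ) ≤ (u + κ) * t (J + 1) := by
          rw [← div_le_iff₀ ht0']; linarith [(abs_le.1 hrat2').2]
        have h3 : ((⌊κ * t (J + 1)⌋₊ : ℕ) : ℝ) + t J ≤ t (J + 1) := by nlinarith
        exact_mod_cast h3
      have htr : (t (J + 1) : ℝ) ≤ r' * t J := by
        rw [inv_eq_one_div, div_lt_div_iff₀ (by linarith) ht0'] at hrat1
        linarith
      have h1 := le_measure_goodPath_step (w := w) (ρ := ρ) (t := t J) (t' := t (J + 1)) hmeas
        hindep hident hA.isClosed
        (Finset.measurableSet_biUnion _ fun i _ => measurableSet_jumpPath _ _ _ i)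
        (fun x hx hy => ?_) (hjmp _ hwin (Nat.sub_le _ _))
      · refine le_trans ?_ h1
        have h2 : Real.exp (-(a * ((J + 1 : ℕ) : ℝ))) ≤ (t (J + 1) : ℝ) ^ (-q) := by
          calc Real.exp (-(a * ((J + 1 : ℕ) : ℝ))) = (r ^ (J + 1)) ^ (-q) := by
                rw [Real.rpow_def_of_pos (by positivity), Real.log_pow, ha]
                congr 1
                ring
            _ ≤ (t (J + 1) : ℝ) ^ (-q) :=
                Real.rpow_le_rpow_of_nonpos ht0' (htle _) (by linarith)
        refine le_trans (le_of_eq ?_) (mul_le_mul ih h2 (Real.exp_pos _).le measureReal_nonneg)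
        rw [mul_assoc p₀, ← Real.exp_add]
        congr 2
        push_cast
        ring
      · obtain ⟨i, hi, hyi⟩ := Set.mem_iUnion₂.1 hy
        have hi' := Finset.mem_Ico.1 hi
        exact goodPath_step hηA hr'1.le hκ0.le (by linarith) (by linarith) (by linarith)
          (by linarith) ht1 htJ htr hrat2' hi'.1 hi'.2 hx hyi
  refine ⟨Real.log p₀ + a * (j₀ * (j₀ + 1) / 2), ?_⟩
  have hJtop : Tendsto (fun n : ℕ => ⌈Real.log n / Real.log r⌉₊) atTop atTop :=
    tendsto_nat_ceil_atTop.comp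
      ((Real.tendsto_log_atTop.comp tendsto_natCast_atTop_atTop).atTop_div_const hlogr)
  filter_upwards [hJtop.eventually_ge_atTop j₀, eventually_ge_atTop 1] with n hn hn1
  have hn0 : (0 : ℝ) < n := by exact_mod_cast hn1
  have hnt : n ≤ t ⌈Real.log n / Real.log r⌉₊ := by
    rw [ht]
    refine Nat.le_floor ?_
    rw [← Real.log_le_log_iff hn0 (by positivity), Real.log_pow, ← div_le_iff₀ hlogr]
    exact Nat.le_ceil _
  calc _ = p₀ * Real.exp (a * (j₀ * (j₀ + 1) / 2) - a * ((⌈Real.log n / Real.log r⌉₊ : ℝ) *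
        (⌈Real.log n / Real.log r⌉₊ + 1) / 2)) := by
        rw [add_sub_assoc, Real.exp_add, Real.exp_log hp₀]
    _ ≤ _ := hchain _ hn
    _ ≤ P.real (persistenceEvent X A n) := measureReal_mono fun ω hω k hk1 hk2 =>
        hω.1 k hk1 (hk2.trans hnt)

end LowerBound

/-! ### Passage to the limit -/

theorem tendsto_log_natCast_atTop : Tendsto (fun n : ℕ => Real.log n) atTop atTop :=
  Real.tendsto_log_atTop.comp tendsto_natCast_atTop_atTop

/-- The exponents of the two bounds are asymptotically the same multiple of `(log n) ^ 2`. -/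
theorem tendsto_exponent {L : ℝ} (hL : 0 < L) (C q : ℝ) {J : ℕ → ℝ}
    (hJ : Tendsto (fun n : ℕ => J n / (Real.log n / L)) atTop (𝓝 1)) :
    Tendsto (fun n : ℕ => 1 / Real.log n ^ 2 * (C - q * L * (J n * (J n + 1) / 2))) atTop
      (𝓝 (-(q / (2 * L)))) := by
  have hinv : Tendsto (fun n : ℕ => (Real.log n)⁻¹) atTop (𝓝 0) :=
    tendsto_inv_atTop_zero.comp tendsto_log_natCast_atTop
  have h1 := ((hinv.mul hinv).const_mul C).sub
    ((((hJ.mul_const L⁻¹).mul ((hJ.mul_const L⁻¹).add hinv)).const_mul (q * L / 2)))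
  have h2 : C * (0 * 0) - q * L / 2 * (1 * L⁻¹ * (1 * L⁻¹ + 0)) = -(q / (2 * L)) := by
    field_simp
    simp
  rw [h2] at h1
  refine h1.congr' ?_
  filter_upwards [tendsto_log_natCast_atTop.eventually_gt_atTop 0] with n hn
  field_simp

section Main

variable {d : ℕ} {Ω : Type*} [MeasurableSpace Ω] {P : Measure Ω} [IsProbabilityMeasure P]
  {X : ℕ → Ω → EuclideanSpace ℝ (Fin d)} {α : ℝ} {μ : Measure (EuclideanSpace ℝ (Fin d))}

/-- Maximal deviations of a centred walk with regularly varying steps. -/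
theorem IsMultRegVarying.maximal_deviation (h : IsMultRegVarying P (X 0) α μ) (hd : 0 < d)
    (hα : 1 < α) (hμ : 0 < μ {x | 1 < ‖x‖}) (hmeas : ∀ i, Measurable (X i))
    (hindep : iIndepFun X P) (hident : ∀ i, IdentDistrib (X i) (X 0) P P)
    (hint : Integrable (X 0) P) (hmean : ∫ ω, X 0 ω ∂P = 0) {q : ℝ} (hq : 0 < q)
    (hqα : q < α - 1) {δ : ℝ} (hδ : 0 < δ) :
    ∀ᶠ m : ℕ in atTop,
      P.real {ω | ∃ k ≤ m, δ * m < ‖∑ i ∈ Finset.range k, X i ω‖} ≤ (m : ℝ) ^ (-q) := by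
  obtain ⟨p, hp1, hp2⟩ := exists_between (lt_min hα one_lt_two)
  have hpα := hp2.trans_le (min_le_left _ _)
  obtain ⟨r, hqr, hrα⟩ := exists_between (show q + 1 < α by linarith)
  obtain ⟨C, x₀, -, -, htail⟩ := h.tail_le hμ (show 0 < r by linarith) hrα
  exact _root_.maximal_deviation hd hmeas hindep hident hint hmean hp1
    (hp2.trans_le (min_le_right _ _)).le
    (h.integrable_norm_rpow (hmeas 0) hμ (by linarith) hpα) htail hq hqr hδ

end Main

theorem theorem2p1 {d : ℕ} (hd : 2 ≤ d)
    {Ω : Type*} [MeasurableSpace Ω] (P : Measure Ω) [IsProbabilityMeasure P]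
    (X : ℕ → Ω → EuclideanSpace ℝ (Fin d))
    (hmeas : ∀ i, Measurable (X i))
    (hindep : iIndepFun X P)
    (hident : ∀ i, IdentDistrib (X i) (X 0) P P)
    (α : ℝ) (hα : 1 < α)
    (μ : Measure (EuclideanSpace ℝ (Fin d)))
    (hRV : IsMultRegVarying P (X 0) α μ)
    (hint : Integrable (X 0) P) (hmean : ∫ ω, X 0 ω ∂P = 0)
    (hac : angularMeasure μ ≪ (volume : Measure (EuclideanSpace ℝ (Fin d))).toSphere)
    (hpos : ∀ D : Set (Metric.sphere (0 : EuclideanSpace ℝ (Fin d)) 1),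
      IsOpen D → D.Nonempty → 0 < angularMeasure μ D)
    (A : Set (EuclideanSpace ℝ (Fin d)))
    (hcompact : IsCompact A) (hconvex : Convex ℝ A)
    (hinterior : (interior A).Nonempty) (hzero : 0 ∉ closure A)
    (hjump : 0 < P {ω | X 0 ω ∈ interior A}) :
    Tendsto
      (fun n : ℕ => 1 / (Real.log n) ^ 2 * Real.log (P.real (persistenceEvent X A n)))
      atTop (𝓝 (-((α - 1) / (2 * Real.log (rStar A))))) := by
  have hd0 : 0 < d := by omega
  have hα0 : 0 < α := by linarith
  have h0 : 0 ∉ A := fun h => hzero (subset_closure h)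
  have hne : Nonempty (Fin d) := ⟨⟨0, hd0⟩⟩
  have hμ : 0 < μ {x | 1 < ‖x‖} := by
    obtain ⟨v, hv⟩ := exists_norm_eq (EuclideanSpace ℝ (Fin d)) zero_le_two
    refine hRV.measure_open_pos hα0 hpos (isOpen_lt continuous_const continuous_norm) (x := v) ?_ ?_
    · show 1 < ‖v‖
      rw [hv]; exact one_lt_two
    · exact norm_ne_zero_iff.1 (by rw [hv]; exact two_ne_zero)
  have hdev : ∀ q : ℝ, 0 < q → q < α - 1 → ∀ δ : ℝ, 0 < δ → ∀ᶠ m : ℕ in atTop,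
      P.real {ω | ∃ k ≤ m, δ * m < ‖∑ i ∈ Finset.range k, X i ω‖} ≤ (m : ℝ) ^ (-q) :=
    fun q hq hqα δ hδ =>
      hRV.maximal_deviation hd0 hα hμ hmeas hindep hident hint hmean hq hqα hδ
  have hr1 := one_lt_rStar hcompact hconvex h0 hinterior
  have hlogr := Real.log_pos hr1
  have hlogtop := tendsto_log_natCast_atTop
  -- Both bounds hold with `r* - s` and `α - 1 + s` in place of `r*` and `α - 1`: the lower one for
  -- small `s > 0` and the upper one for small `s < 0`.
  have hrate : Tendsto (fun s : ℝ => -((α - 1 + s) / (2 * Real.log (rStar A - s)))) (𝓝 0)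
      (𝓝 (-((α - 1) / (2 * Real.log (rStar A))))) := by
    have hlog : ContinuousAt (fun s : ℝ => Real.log (rStar A - s)) 0 :=
      ContinuousAt.log (by fun_prop) (by rw [sub_zero]; linarith)
    have hcont : ContinuousAt (fun s : ℝ => -((α - 1 + s) / (2 * Real.log (rStar A - s)))) 0 :=
      ((by fun_prop : ContinuousAt (fun s : ℝ => α - 1 + s) 0).div (hlog.const_mul 2)
        (by rw [sub_zero]; positivity)).neg
    have := hcont.tendsto
    simpa only [add_zero, sub_zero] using this
  have hlower : ∀ s : ℝ, 0 < s → s < rStar A - 1 → ∃ C : ℝ, ∀ᶠ n : ℕ in atTop,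
      Real.exp (C - (α - 1 + s) * Real.log (rStar A - s) *
        ((⌈Real.log n / Real.log (rStar A - s)⌉₊ : ℝ) *
        (⌈Real.log n / Real.log (rStar A - s)⌉₊ + 1) / 2)) ≤ P.real (persistenceEvent X A n) := by
    intro s hs hs1
    refine persistence_lower_bound hmeas hindep hident hd0 hcompact hconvex h0 hinterior hjump
      (q₁ := α + s / 2) (by linarith) (by linarith) (by linarith) (by linarith) (fun δ hδ => ?_)
      (fun b hb ρ hρ => hRV.le_measure_ball hα0 hpos hμ hb hρ (by linarith))
    have hα2 : 0 < (α - 1) / 2 := by linarith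
    have hsmall := (tendsto_rpow_neg_atTop hα2).comp (tendsto_natCast_atTop_atTop (R := ℝ))
    filter_upwards [hdev _ hα2 (by linarith) δ hδ,
      hsmall.eventually_le_const (show (0 : ℝ) < 1 / 4 by norm_num)] with m h1 h2
    exact h1.trans h2
  have hpositive : ∀ᶠ n : ℕ in atTop, 0 < P.real (persistenceEvent X A n) := by
    obtain ⟨C, hC⟩ := hlower ((rStar A - 1) / 2) (by linarith) (by linarith)
    filter_upwards [hC] with n hn using (Real.exp_pos _).trans_le hn
  refine tendsto_order.2 ⟨fun a ha => ?_, fun a ha => ?_⟩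
  · obtain ⟨s, ⟨hsa, hs1⟩, hs0⟩ := (((hrate.eventually_const_lt ha).and
      (eventually_lt_nhds (show 0 < rStar A - 1 by linarith))).filter_mono
        nhdsWithin_le_nhds |>.and (self_mem_nhdsWithin (s := Set.Ioi (0 : ℝ)))).exists
    replace hs0 : 0 < s := hs0
    have hL : 0 < Real.log (rStar A - s) := Real.log_pos (by linarith)
    obtain ⟨C, hC⟩ := hlower s hs0 hs1
    have hlim := tendsto_exponent hL C (α - 1 + s)
      (tendsto_nat_ceil_div_atTop.comp (hlogtop.atTop_div_const hL))
    filter_upwards [hlim.eventually_const_lt hsa, hC] with n h1 h2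
    refine h1.trans_le (mul_le_mul_of_nonneg_left ?_ (by positivity))
    exact (Real.le_log_iff_exp_le ((Real.exp_pos _).trans_le h2)).2 h2
  · obtain ⟨s, ⟨hsa, hs1⟩, hs0⟩ := (((hrate.eventually_lt_const ha).and
      (eventually_gt_nhds (show -(α - 1) < 0 by linarith))).filter_mono
        nhdsWithin_le_nhds |>.and (self_mem_nhdsWithin (s := Set.Iio (0 : ℝ)))).exists
    replace hs0 : s < 0 := hs0
    have hL : 0 < Real.log (rStar A - s) := Real.log_pos (by linarith)
    obtain ⟨C, hC⟩ := persistence_upper_bound hmeas hindep hident hcompact hconvex h0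
      (q := α - 1 + s) (r := rStar A - s) (by linarith) (by linarith) (by linarith)
      (hdev _ (by linarith) (by linarith))
    have hlim := tendsto_exponent hL C (α - 1 + s)
      (tendsto_nat_floor_div_atTop.comp (hlogtop.atTop_div_const hL))
    filter_upwards [hlim.eventually_lt_const hsa, hC, hpositive] with n h1 h2 h3
    refine (mul_le_mul_of_nonneg_left ?_ (by positivity)).trans_lt h1
    exact (Real.log_le_iff_le_exp h3).2 h2
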